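/- **Model sets.** Let $w_1,\dots,w_L$ be internal signals, $r_1,\dots,r_K$ measured excitation signals, $\mathcal C\subseteq\{w_1,\dots,w_L\}$ the measured internal signals, $c=|\mathcal C|$, and $\tilde e$ a vector of $c$ white noises, one for each signal of $\mathcal C$. Order $w$ so that the signals of $\mathcal C$ come first. A *network model set* $\mathcal M$ is a family, indexed by $\theta\in\Theta\subseteq\mathbb R^n$, of models $$w=G(q,\theta)w+Rr+\begin{bmatrix}\tilde H(q,\theta)\\0\end{bmatrix}\tilde e,\qquad w_{\mathcal C}=Cw,\qquad \operatorname{cov}\tilde e=\tilde\Lambda(\theta),$$ where $C$ consists of the rows of the $L\times L$ identity that belong to $\mathcal C$, $R$ consists of $K$ (distinct) columns of the identity, and the entries of $G$ and $\tilde H$ are real rational functions of $q$, parameterized rationally in $\theta$. For every $\theta\in\Theta$: $G$ is proper, stable and has zero diagonal; $T=(I-G)^{-1}$ is stable; all principal minors of $I-G(\infty)$ are non-zero; the $c\times c$ matrix $\tilde H$ is proper, stable, monic ($\tilde H(\infty)=I$) and minimum phase; $\tilde\Lambda$ is real symmetric positive semidefinite. Here *stable* means that all poles lie in $|z|<1$,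 and a square transfer matrix is *minimum phase* if it is invertible and its inverse has no pole in $|z|>1$. Put $$X=\begin{bmatrix}R&\begin{bmatrix}\tilde H\\0\end{bmatrix}\end{bmatrix},\qquad \Phi(\omega)=T(e^{i\omega})\begin{bmatrix}\tilde H\\0\end{bmatrix}\tilde\Lambda\begin{bmatrix}\tilde H\\0\end{bmatrix}^{*}T(e^{i\omega})^{*},$$ with $\tilde H$ taken at $e^{i\omega}$ in the second formula. $G_{ji}$ is *generically identifiable in $\mathcal M$ from $(w_{\mathcal C},r)$* if for all $\theta_0\in\Theta$ outside a Lebesgue null set and all $\theta_1\in\Theta$: if $CTR$ and $C\Phi C^\top$ are the same for $\theta_0$ and $\theta_1$, then $G_{ji}(q,\theta_0)=G_{ji}(q,\theta_1)$. **Graph.** The vertices are the internal signals and the external signals $\mathcal X$ (all $r_p$ and $\tilde e_k$). There is an edge $w_i\to w_j$ (respectively from an external signal $x$ to $w_j$) iff $G_{ji}$ (respectively $X_{jx}$) is not identically zero on $\Theta$. The edge is *known* if the entry does not depend on $\theta\in\Theta$, otherwise *unknown*. A path has no repeated vertex; a single vertex is a path. $b_{\mathcal V_1\to\mathcal V_2}$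 is the maximal number of pairwise vertex disjoint directed paths from $\mathcal V_1$ to $\mathcal V_2$ (disjoint also in their end points). $\mathcal X_j$ is the set of external signals that have no unknown edge to $w_j$. $\mathcal N_i^+$ is the set of out-neighbours of $w_i$, excluding those $w_k$ for which $w_i\to w_k$ is known *and* some external signal of out-degree one has a known edge to $w_k$. **Assumptions.** 1. For every $\theta\in\Theta$, $C\Phi(\omega)C^\top$ has full rank for almost all $\omega$. 2. The entries of $G$ and $\tilde H$ are parameterized independently: different entries depend on disjoint sets of parameters. 3. Either $G(q,\theta)$ is strictly proper for all $\theta\in\Theta$; or $\tilde\Lambda(\theta)$ is diagonal for all $\theta\in\Theta$ and there is a permutation matrix $P$ such that $PG(\infty,\theta)P^\top$ is lower triangular for all $\theta\in\Theta$. 4. Every submatrix of $[\,G-I\;\;X\,]$ that does not depend on $\theta$ has rank equal to its structural rank (the maximal rank of a matrix with the same pattern of nonzero entries). 5. For every $\theta\in\Theta$, the $c\times c$ spectral factor $CT\begin{bmatrix}\tilde H\\0\end{bmatrix}$ is minimum phase. **Proposition.** Let $\mathcal M$ satisfy Assumptions 1–5, and let $x_i,x_j\in\mathcal X$ be external signals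 of out-degree one with known edges to $w_i$ and $w_j$, respectively. If for some $\bar{\mathcal X}\subseteq\mathcal X_j\setminus\{x_j\}$ and $\bar{\mathcal C}\subseteq\mathcal C$ $$b_{\mathcal N_i^+\cup\bar{\mathcal X}\to\bar{\mathcal C}}=b_{(\mathcal N_i^+\setminus\{w_j\})\cup\bar{\mathcal X}\to\bar{\mathcal C}}+1\quad\text{and}\quad b_{(\mathcal N_i^+\setminus\{w_j\})\cup\bar{\mathcal X}\to\bar{\mathcal C}}=b_{\bar{\mathcal X}\to\bar{\mathcal C}},$$ then $G_{ji}$ is generically identifiable in $\mathcal M$ from $(w_{\mathcal C},r)$. -/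

import Mathlib

open scoped Matrix
open MeasureTheory

noncomputable section

/-! ### Scalar transfer functions: real rational functions of `z` -/

/-- A transfer function is proper: the degree of the numerator is at most that of the denominator
(`num` and `denom` are coprime and `denom` is monic). -/
def IsProperTF (f : RatFunc ℝ) : Prop := f.num.degree ≤ f.denom.degree

/-- Strictly proper. -/
def IsStrictlyProperTF (f : RatFunc ℝ) : Prop := f.num.degree < f.denom.degree

/-- Stable: all (complex) poles lie in the open unit disc. -/
def IsStableTF (f : RatFunc ℝ) : Prop :=
  ∀ z : ℂ, Polynomial.aeval z f.denom = 0 → ‖z‖ < 1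

/-- The value at `z = ∞` of a proper transfer function (the denominator is monic). -/
def valueAtInfinity (f : RatFunc ℝ) : ℝ := f.num.coeff f.denom.natDegree

/-- `valueAtInfinity` is the limit as `z → ∞`. -/
theorem tendsto_valueAtInfinity (f : RatFunc ℝ) (hf : IsProperTF f) :
    Filter.Tendsto (fun x : ℝ => f.eval (RingHom.id ℝ) x) Filter.atTop
      (nhds (valueAtInfinity f)) := by
  have hm : f.denom.Monic := RatFunc.monic_denom f
  have e : (fun x : ℝ => f.eval (RingHom.id ℝ) x)
      = fun x => f.num.eval x / f.denom.eval x := by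
    funext x
    simp [RatFunc.eval, Polynomial.eval₂_id]
  rw [e]
  rcases lt_or_eq_of_le hf with h | h
  · have h0 : valueAtInfinity f = 0 := by
      unfold valueAtInfinity
      apply Polynomial.coeff_eq_zero_of_degree_lt
      rwa [← Polynomial.degree_eq_natDegree hm.ne_zero]
    rw [h0]
    exact Polynomial.div_tendsto_atTop_zero_of_degree_lt _ _ h
  · have h1 : valueAtInfinity f = f.num.leadingCoeff / f.denom.leadingCoeff := by
      unfold valueAtInfinity
      rw [hm.leadingCoeff, div_one, Polynomial.leadingCoeff,
        Polynomial.natDegree_eq_natDegree h]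
    rw [h1]
    exact Polynomial.div_tendsto_atTop_leadingCoeff_div_of_degree_eq _ _ h

/-- A square transfer matrix is minimum phase: it is invertible and its inverse has no pole outside
the closed unit disc. -/
def IsMinimumPhase {ι : Type*} [Fintype ι] [DecidableEq ι] (A : Matrix ι ι (RatFunc ℝ)) : Prop :=
  IsUnit A.det ∧ ∀ a b, ∀ z : ℂ, Polynomial.aeval z (A⁻¹ a b).denom = 0 → ‖z‖ ≤ 1

/-- The structural rank: the maximal rank of a matrix with the same nonzero pattern. -/
def structuralRank {ι κ F : Type*} [Fintype κ] [Field F] (A : Matrix ι κ F) : ℕ :=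
  sSup {k | ∃ B : Matrix ι κ F, (∀ a b, B a b = 0 ↔ A a b = 0) ∧ B.rank = k}

/-! ### Rational parameterizations -/

/-- On `Θ`, the transfer function `f θ` is a quotient of two polynomials in `z` whose coefficients
are polynomials in those parameters whose index lies in `S`. -/
def IsRationalIn {n : ℕ} (Θ : Set (Fin n → ℝ)) (S : Set (Fin n))
    (f : (Fin n → ℝ) → RatFunc ℝ) : Prop :=
  ∃ p d : Polynomial (MvPolynomial (Fin n) ℝ),
    (∀ k, ((p.coeff k).vars : Set (Fin n)) ⊆ S) ∧
    (∀ k, ((d.coeff k).vars : Set (Fin n)) ⊆ S) ∧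
    ∀ θ ∈ Θ, d.map (MvPolynomial.eval θ) ≠ 0 ∧
      f θ = algebraMap (Polynomial ℝ) (RatFunc ℝ) (p.map (MvPolynomial.eval θ)) /
        algebraMap (Polynomial ℝ) (RatFunc ℝ) (d.map (MvPolynomial.eval θ))

/-! ### Parameterized network model sets -/

/-- A parameterized network model set with `L` internal signals `w`, `K` measured excitation
signals `r`, `n` real parameters, measured internal signals `C`, and one noise signal for every
measured internal signal:
`w = G(q,θ) w + R r + [H(q,θ); 0] e`, `w_C = C w`, with `cov e = Λ(θ)`. -/
structure NetworkModelSet (L K n : ℕ) where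
  /-- the parameter set -/
  Θ : Set (Fin n → ℝ)
  /-- the measured internal signals -/
  C : Finset (Fin L)
  /-- `r_p` enters the internal signal `exc p`; distinct signals enter distinct vertices -/
  exc : Fin K ↪ Fin L
  /-- the modules; `G θ j i` is the transfer function from `w_i` to `w_j` -/
  G : (Fin n → ℝ) → Matrix (Fin L) (Fin L) (RatFunc ℝ)
  /-- the square noise filter of the measured internal signals -/
  H : (Fin n → ℝ) → Matrix C C (RatFunc ℝ)
  /-- the noise covariance matrix -/
  Λ : (Fin n → ℝ) → Matrix C C ℝ
  G_rational : ∀ j i, IsRationalIn Θ Set.univ (fun θ => G θ j i)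
  H_rational : ∀ a b, IsRationalIn Θ Set.univ (fun θ => H θ a b)
  G_proper : ∀ θ ∈ Θ, ∀ j i, IsProperTF (G θ j i)
  G_stable : ∀ θ ∈ Θ, ∀ j i, IsStableTF (G θ j i)
  G_hollow : ∀ θ ∈ Θ, ∀ i, G θ i i = 0
  /-- well-posedness: all principal minors of `I - G(∞)` are non-zero -/
  wellPosed : ∀ θ ∈ Θ, ∀ s : Finset (Fin L),
    ((1 - (G θ).map valueAtInfinity).submatrix
      (Subtype.val : s → Fin L) (Subtype.val : s → Fin L)).det ≠ 0
  T_stable : ∀ θ ∈ Θ, ∀ j i, IsStableTF ((1 - G θ)⁻¹ j i)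
  H_proper : ∀ θ ∈ Θ, ∀ a b, IsProperTF (H θ a b)
  H_stable : ∀ θ ∈ Θ, ∀ a b, IsStableTF (H θ a b)
  H_monic : ∀ θ ∈ Θ, (H θ).map valueAtInfinity = 1
  H_minimumPhase : ∀ θ ∈ Θ, IsMinimumPhase (H θ)
  Λ_posSemidef : ∀ θ ∈ Θ, (Λ θ).PosSemidef

namespace NetworkModelSet

variable {L K n : ℕ} (M : NetworkModelSet L K n)

/-- The selection matrix `C`: the rows of the identity that belong to the measured signals. -/
def selC (F : Type*) [Zero F] [One F] : Matrix M.C (Fin L) F :=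
  (1 : Matrix (Fin L) (Fin L) F).submatrix Subtype.val id

/-- The binary matrix `R`: the columns of the identity that belong to the excited signals. -/
def R (F : Type*) [Zero F] [One F] : Matrix (Fin L) (Fin K) F :=
  (1 : Matrix (Fin L) (Fin L) F).submatrix id M.exc

/-- The noise model `[H; 0]`: the noise does not enter the unmeasured signals. -/
def noise (θ : Fin n → ℝ) : Matrix (Fin L) M.C (RatFunc ℝ) :=
  fun k a => if hk : k ∈ M.C then M.H θ ⟨k, hk⟩ a else 0

/-- `T = (I - G)⁻¹`. -/
def T (θ : Fin n → ℝ) : Matrix (Fin L) (Fin L) (RatFunc ℝ) := (1 - M.G θ)⁻¹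

/-- The frequency response of a transfer matrix: its value at `z = e^{iω}`. -/
def _root_.freqResponse {ι κ : Type*} (A : Matrix ι κ (RatFunc ℝ)) (ω : ℝ) : Matrix ι κ ℂ :=
  A.map (RatFunc.eval (algebraMap ℝ ℂ) (Complex.exp (ω * Complex.I)))

/-- The power spectrum
`Φ(ω) = (I - G(e^{iω}))⁻¹ H(e^{iω}) Λ H(e^{iω})ᴴ (I - G(e^{iω}))⁻ᴴ` of `w`. -/
def Φ (θ : Fin n → ℝ) (ω : ℝ) : Matrix (Fin L) (Fin L) ℂ :=
  (1 - freqResponse (M.G θ) ω)⁻¹ * freqResponse (M.noise θ) ω *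
    (M.Λ θ).map (algebraMap ℝ ℂ) *
    (freqResponse (M.noise θ) ω)ᴴ * ((1 - freqResponse (M.G θ) ω)⁻¹)ᴴ

/-- The first object available from data: `C T R`. -/
def CTR (θ : Fin n → ℝ) : Matrix M.C (Fin K) (RatFunc ℝ) :=
  M.selC (RatFunc ℝ) * M.T θ * M.R (RatFunc ℝ)

/-- The second object available from data: the spectrum `C Φ Cᵀ` of the measured signals. -/
def spectrumC (θ : Fin n → ℝ) (ω : ℝ) : Matrix M.C M.C ℂ :=
  M.selC ℂ * M.Φ θ ω * (M.selC ℂ)ᵀ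

/-- `G_ji` is generically identifiable from `(w_C, r)`: for almost all `θ₀ ∈ Θ` (all but a
Lebesgue null set), every `θ₁ ∈ Θ` that gives the same `C T R` and the same `C Φ Cᵀ` gives the same
`G_ji`. -/
def GenericallyIdentifiable (j i : Fin L) : Prop :=
  ∀ᵐ θ₀ ∂(volume : Measure (Fin n → ℝ)), θ₀ ∈ M.Θ → ∀ θ₁ ∈ M.Θ,
    M.CTR θ₀ = M.CTR θ₁ → (∀ ω : ℝ, M.spectrumC θ₀ ω = M.spectrumC θ₁ ω) →
      M.G θ₀ j i = M.G θ₁ j i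

/-! ### Graph -/

/-- The external signals: the measured excitations `r` and the noises `e`. -/
abbrev Ext : Type := Fin K ⊕ M.C

/-- The vertices of the graph: internal signals (`Sum.inl`) and external signals (`Sum.inr`). -/
abbrev Vertex : Type := Fin L ⊕ M.Ext

/-- `X = [R  [H; 0]]`. -/
def X (θ : Fin n → ℝ) : Matrix (Fin L) M.Ext (RatFunc ℝ) :=
  Matrix.fromCols (M.R (RatFunc ℝ)) (M.noise θ)

/-- `[G X]`: the entry at `(j, v)` is the transfer function on the potential edge `v → w_j`. -/
def entry (θ : Fin n → ℝ) : Matrix (Fin L) M.Vertex (RatFunc ℝ) :=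
  Matrix.fromCols (M.G θ) (M.X θ)

/-- There is an edge `v → w_j` iff the corresponding entry is not fixed to zero. No edge ends in an
external signal. -/
def Edge : M.Vertex → M.Vertex → Prop
  | v, Sum.inl j => ∃ θ ∈ M.Θ, M.entry θ j v ≠ 0
  | _, Sum.inr _ => False

/-- The entry from `v` to `w_j` is known (fixed): it does not depend on the parameters. -/
def Known (v : M.Vertex) (j : Fin L) : Prop :=
  ∀ θ₀ ∈ M.Θ, ∀ θ₁ ∈ M.Θ, M.entry θ₀ j v = M.entry θ₁ j v

/-- The number of out-neighbours of a vertex. -/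
def outDegree (v : M.Vertex) : ℕ := {u | M.Edge v u}.ncard

/-- A directed path from `V₁` to `V₂`, given by its sequence of vertices, without repeated vertices.
A single vertex is a path from itself to itself. -/
def IsPath (V₁ V₂ : Set M.Vertex) (l : List M.Vertex) : Prop :=
  l.IsChain M.Edge ∧ l.Nodup ∧ (∃ u ∈ l.head?, u ∈ V₁) ∧ (∃ v ∈ l.getLast?, v ∈ V₂)

/-- `b_{V₁ → V₂}`: the maximal number of pairwise vertex disjoint paths from `V₁` to `V₂`. -/
def maxDisjointPaths (V₁ V₂ : Set M.Vertex) : ℕ :=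
  sSup {k | ∃ p : Fin k → List M.Vertex, (∀ a, M.IsPath V₁ V₂ (p a)) ∧
    ∀ a b, a ≠ b → (p a).Disjoint (p b)}

/-- The external signal `x` has out-degree one, and its edge goes to `w_k` and is known. -/
def IsKnownExcitation (x : M.Ext) (k : Fin L) : Prop :=
  M.outDegree (Sum.inr x) = 1 ∧ M.Edge (Sum.inr x) (Sum.inl k) ∧ M.Known (Sum.inr x) k

/-- `X_j`: the external signals without unknown edge to `w_j`. -/
def extNoUnknown (j : Fin L) : Set M.Ext :=
  {x | ¬ (M.Edge (Sum.inr x) (Sum.inl j) ∧ ¬ M.Known (Sum.inr x) j)}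

/-- `N_i⁺`: the out-neighbours of `w_i`, except those to which `w_i` has a known edge and which are
excited by an external signal of out-degree one with a known edge. -/
def Nplus (i : Fin L) : Set (Fin L) :=
  {k | M.Edge (Sum.inl i) (Sum.inl k) ∧
    ¬ (M.Known (Sum.inl i) k ∧ ∃ x, M.IsKnownExcitation x k)}

/-! ### Standing assumptions -/

/-- The spectrum `C Φ(ω) Cᵀ` has full rank for almost all `ω`. -/
def FullRankSpectrum : Prop :=
  ∀ θ ∈ M.Θ, ∀ᵐ ω : ℝ, (M.spectrumC θ ω).rank = M.C.card

/-- The transfer functions in `G` and `H` are parameterized independently: different entries depend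
on disjoint sets of parameters. -/
def IndependentlyParameterized : Prop :=
  ∃ (SG : Fin L → Fin L → Set (Fin n)) (SH : M.C → M.C → Set (Fin n)),
    (∀ j i, IsRationalIn M.Θ (SG j i) (fun θ => M.G θ j i)) ∧
    (∀ a b, IsRationalIn M.Θ (SH a b) (fun θ => M.H θ a b)) ∧
    (∀ j i j' i', (j, i) ≠ (j', i') → Disjoint (SG j i) (SG j' i')) ∧
    (∀ a b a' b', (a, b) ≠ (a', b') → Disjoint (SH a b) (SH a' b')) ∧
    (∀ j i a b, Disjoint (SG j i) (SH a b))

/-- Either all modules are strictly proper, or `Λ` is diagonal and there are no algebraic loops: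
one simultaneous permutation of rows and columns makes `G(∞, θ)` lower triangular. -/
def FeedthroughCondition : Prop :=
  (∀ θ ∈ M.Θ, ∀ j i, IsStrictlyProperTF (M.G θ j i)) ∨
  ((∀ θ ∈ M.Θ, (M.Λ θ).IsDiag) ∧
    ∃ σ : Equiv.Perm (Fin L), ∀ θ ∈ M.Θ, ∀ a b, a < b →
      valueAtInfinity (M.G θ (σ a) (σ b)) = 0)

/-- Every submatrix of `[G - I  X]` that does not depend on `θ` has rank equal to its structural
rank. -/
def FixedEntriesRegular : Prop :=
  ∀ (rows : Finset (Fin L)) (cols : Finset M.Vertex),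
    let A : (Fin n → ℝ) → Matrix rows cols (RatFunc ℝ) := fun θ =>
      (Matrix.fromCols (M.G θ - 1) (M.X θ)).submatrix Subtype.val Subtype.val
    (∀ θ₀ ∈ M.Θ, ∀ θ₁ ∈ M.Θ, A θ₀ = A θ₁) →
      ∀ θ ∈ M.Θ, (A θ).rank = structuralRank (A θ)

/-- The spectral factor `C T [H; 0]` of the measured spectrum is minimum phase. (It is stable and
invertible at infinity by the laws of a model set; when all internal signals are measured it is
automatically minimum phase.) -/
def MinimumPhaseFactor : Prop :=
  ∀ θ ∈ M.Θ, IsMinimumPhase (M.selC (RatFunc ℝ) * M.T θ * M.noise θ)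

end NetworkModelSet

end

/-! Equal data give equal `C T X`. Both spectral factors `C T [H; 0]`, times square roots of the
covariances, are stable, minimum phase, invertible at infinity and have the same spectrum. Their
quotient is unitary on the circle, and reflection in the circle leaves it no pole on the sphere, so
it is a constant matrix. The feedthrough condition forces the resulting constant between the factors
to be the identity (`factor_eq_of_spectrumC_eq`). A known excitation has a constant multiple of a
unit vector as its column of `X`, so it determines the measured part of the corresponding column of
`T`.

Ranks of transfer matrices are governed by disjoint paths. The number of paths bounds the rank for
every parameter (`finrank_span_responseOn_le`): a nonzero minor gives a permutation in a bordered
matrix, and its cycles are the paths. The bound is attained for almost every parameter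
(`ae_maxDisjointPaths_le_finrank`): disjoint paths give a perfect matching in a square part of `[G -
I X]`, and a matching makes a determinant with independent entries generically nonzero. The constant
parts are covered by the rank assumption.

For the module itself, let `W` be the span of the responses to the chosen external signals,
restricted to the chosen measured signals. It is the same for both parameters. The second path
equality and the universal upper bound put the responses to the relevant out-neighbours other than
`w_j` into `W`, for the generic parameter and also for the arbitrary one. The first path equality
keeps the response to `w_j` outside `W`. A functional `φ` that kills `W` but not this response,
applied to column `i` of `T (I - G) = I`, leaves `G_ji` as the only term that could differ. -/

noncomputable section

/-! ### Zero sets of polynomials -/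

/-- A nonzero real polynomial is nonzero almost everywhere. -/
theorem MvPolynomial.ae_eval_ne_zero {n : ℕ} (p : MvPolynomial (Fin n) ℝ) (hp : p ≠ 0) :
    ∀ᵐ θ ∂(volume : Measure (Fin n → ℝ)), MvPolynomial.eval θ p ≠ 0 := by
  induction n with
  | zero =>
    refine Filter.Eventually.of_forall fun θ h => hp ?_
    rw [MvPolynomial.eq_C_of_isEmpty p] at h ⊢
    rw [MvPolynomial.eval_C] at h
    rw [h, map_zero]
  | succ n ih =>
    have hq : MvPolynomial.finSuccEquiv ℝ n p ≠ 0 := by simpa using hp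
    have hcont : Continuous fun x : ℝ × (Fin n → ℝ) =>
        MvPolynomial.eval (Fin.cons x.1 x.2 : Fin (n + 1) → ℝ) p := by
      refine (MvPolynomial.continuous_eval p).comp ?_
      exact Continuous.finCons (A := fun _ => ℝ) continuous_fst continuous_snd
    have hmeas : MeasurableSet {x : ℝ × (Fin n → ℝ) |
        MvPolynomial.eval (Fin.cons x.1 x.2 : Fin (n + 1) → ℝ) p ≠ 0} :=
      (isOpen_ne_fun hcont continuous_const).measurableSet
    have hprod : ∀ᵐ x ∂((volume : Measure ℝ).prod (volume : Measure (Fin n → ℝ))),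
        MvPolynomial.eval (Fin.cons x.1 x.2 : Fin (n + 1) → ℝ) p ≠ 0 := by
      -- Fubini with the last `n` variables outside: where the leading coefficient in the first
      -- variable does not vanish, only finitely many values of that variable are roots.
      rw [Measure.ae_prod_iff_ae_ae hmeas, Measure.ae_ae_comm hmeas]
      filter_upwards [ih _ (Polynomial.leadingCoeff_ne_zero.mpr hq)] with s hs
      have hne : (MvPolynomial.finSuccEquiv ℝ n p).map (MvPolynomial.eval s) ≠ 0 := by
        intro h
        apply hs
        have := congrArg (fun f => Polynomial.coeff f
          (MvPolynomial.finSuccEquiv ℝ n p).natDegree) h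
        simpa using this
      have hfin : {y : ℝ | ((MvPolynomial.finSuccEquiv ℝ n p).map
          (MvPolynomial.eval s)).IsRoot y}.Finite := Polynomial.finite_setOfPred_isRoot hne
      have := hfin.measure_zero volume
      rw [ae_iff]
      convert this using 3 with y
      simp [MvPolynomial.eval_eq_eval_mv_eval', Polynomial.IsRoot]
    have hmp := volume_preserving_piFinSuccAbove (fun _ : Fin (n + 1) => ℝ) 0
    have := hmp.quasiMeasurePreserving.ae hprod
    filter_upwards [this] with θ hθ
    simpa [MeasurableEquiv.piFinSuccAbove, Fin.insertNthEquiv] using hθ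

/-! ### Nonsingularity of matrices with independently varying entries -/

section GenericDeterminant

variable {P F ι κ : Type*} [Field F]

/-- The entries of a family of matrices vary independently of one another on `Ω`. -/
def VariesIndependently (Ω : Set P) (A : P → Matrix ι κ F) : Prop :=
  ∀ E : Set (ι × κ), ∀ θ ∈ Ω, ∀ θ' ∈ Ω, ∃ θ'' ∈ Ω,
    (∀ a b, (a, b) ∈ E → A θ'' a b = A θ' a b) ∧ ∀ a b, (a, b) ∉ E → A θ'' a b = A θ a b

/-- Changing one entry of the diagonal to a suitable value makes a matrix with a nonsingular
complementary minor nonsingular. -/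
theorem Matrix.det_ne_zero_or_of_diag {m : Type*} [Fintype m] [DecidableEq m]
    (A B : Matrix m m F) (a : m) (hAB : A a a ≠ B a a)
    (h : ∀ x y, (x, y) ≠ (a, a) → A x y = B x y)
    (hminor : (A.submatrix (Subtype.val : {x // x ≠ a} → m) (Subtype.val : {x // x ≠ a} → m)).det
      ≠ 0) : A.det ≠ 0 ∨ B.det ≠ 0 := by
  -- The determinant is affine in the entry `(a, a)`, and its slope is the complementary minor. It
  -- therefore cannot vanish at two different values of that entry.
  by_contra! hdet
  have hB : B = A.updateRow a (A a + Pi.single a (B a a - A a a)) := by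
    ext x y
    by_cases hx : x = a
    · subst hx
      by_cases hy : y = x
      · subst hy; simp
      · simp [hy, h x y (by simp [hy])]
    · simp [hx, h x y (by simp [hx])]
  have hsing : (A.updateRow a (Pi.single a (1 : F))).det = (A.submatrix
      (Subtype.val : {x // x ≠ a} → m) (Subtype.val : {x // x ≠ a} → m)).det := by
    rw [Matrix.twoBlockTriangular_det' _ (fun x => x = a)]
    · have e1 : (Matrix.toSquareBlockProp (A.updateRow a (Pi.single a (1 : F)))
          fun x => x = a).det = 1 := by
        rw [Matrix.det_unique]
        simp [Matrix.toSquareBlockProp, (default : {x // x = a}).2]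
      refine (congrArg₂ (· * ·) ?_ ?_).trans (one_mul _)
      · convert e1
      · congr 1
        ext x y
        simp [Matrix.toSquareBlockProp, x.2]
    · intro x hx y hy
      subst hx
      simp [hy]
  have hs : (Pi.single a (B a a - A a a) : m → F) = (B a a - A a a) • Pi.single a (1 : F) := by
    ext y; by_cases hy : y = a
    · subst hy; simp
    · simp [hy]
  have hd := hdet.2
  rw [hB, Matrix.det_updateRow_add, Matrix.updateRow_eq_self, hdet.1, zero_add, hs,
    Matrix.det_updateRow_smul, hsing] at hd
  exact (mul_ne_zero (sub_ne_zero.mpr hAB.symm) hminor) hd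

/-- If the neighbourhoods of the rows other than `a`, in the columns other than `b`, violate Hall's
condition, then a set of rows containing `b` but not `a` has all its neighbours in itself. -/
theorem exists_closed_of_hall_violation {m : Type*} [Fintype m] [DecidableEq m]
    (Q : m → m → Prop) [DecidableRel Q] (hQ : ∀ x, Q x x) (a b : m)
    (h : ¬ ∃ g : {x // x ≠ a} → m, Function.Injective g ∧ ∀ x, g x ≠ b ∧ Q x (g x)) :
    ∃ S : Finset m, a ∉ S ∧ b ∈ S ∧ ∀ x ∈ S, ∀ y, y ∉ S → ¬ Q x y := by
  let t : {x // x ≠ a} → Finset m := fun x => Finset.univ.filter fun y => y ≠ b ∧ Q x y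
  have hH : ¬ ∀ s : Finset {x // x ≠ a}, s.card ≤ (s.biUnion t).card := by
    intro hall
    obtain ⟨g, hg, hgt⟩ := (Finset.all_card_le_biUnion_card_iff_exists_injective t).mp hall
    exact h ⟨g, hg, fun x => by simpa [t] using hgt x⟩
  push Not at hH
  obtain ⟨s, hs⟩ := hH
  let S : Finset m := s.map (Function.Embedding.subtype _)
  have hcard : S.card = s.card := Finset.card_map _
  have hsub : S.erase b ⊆ s.biUnion t := by
    intro y hy
    obtain ⟨hyb, hyS⟩ := Finset.mem_erase.mp hy
    obtain ⟨x, hx, rfl⟩ := Finset.mem_map.mp hyS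
    exact Finset.mem_biUnion.mpr ⟨x, hx, by simpa [t, hQ] using hyb⟩
  have hbS : b ∈ S := by
    by_contra hb
    rw [Finset.erase_eq_of_notMem hb] at hsub
    have := Finset.card_le_card hsub
    omega
  -- The violation of Hall's condition allows at most `s.card - 1` neighbours, and `S.erase b`
  -- already supplies that many, since every row is its own neighbour.
  have heq : S.erase b = s.biUnion t := by
    apply Finset.eq_of_subset_of_card_le hsub
    rw [Finset.card_erase_of_mem hbS]
    omega
  refine ⟨S, ?_, hbS, ?_⟩
  · intro ha
    obtain ⟨x, -, hx⟩ := Finset.mem_map.mp ha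
    exact x.2 hx
  · intro x hx y hy hxy
    apply hy
    by_cases hyb : y = b
    · rwa [hyb]
    · obtain ⟨x', hx', rfl⟩ := Finset.mem_map.mp hx
      have : y ∈ s.biUnion t := Finset.mem_biUnion.mpr ⟨x', hx', by simpa [t, hyb] using hxy⟩
      rw [← heq] at this
      exact Finset.mem_of_mem_erase this

/-- A square selection of independently varying entries whose pattern admits a perfect matching
(given as the diagonal) is nonsingular at some parameter, provided that the selections of constant
entries with this property are nonsingular. -/
theorem exists_det_submatrix_ne_zero (Ω : Set P) (hΩ : Ω.Nonempty) (A : P → Matrix ι κ F)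
    (hind : VariesIndependently Ω A)
    (hfix : ∀ (m : Type) [Fintype m] [DecidableEq m] (r : m → ι) (c : m → κ),
      Function.Injective r → Function.Injective c →
      (∀ x, ∃ θ ∈ Ω, A θ (r x) (c x) ≠ 0) →
      (∀ x y, ∀ θ ∈ Ω, ∀ θ' ∈ Ω, A θ (r x) (c y) = A θ' (r x) (c y)) →
      ∀ θ ∈ Ω, ((A θ).submatrix r c).det ≠ 0)
    (m : Type) [Fintype m] [DecidableEq m] (r : m → ι) (c : m → κ)
    (hr : Function.Injective r) (hc : Function.Injective c)
    (hdiag : ∀ x, ∃ θ ∈ Ω, A θ (r x) (c x) ≠ 0) :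
    ∃ θ ∈ Ω, ((A θ).submatrix r c).det ≠ 0 := by
  classical
  induction hN : Fintype.card m using Nat.strong_induction_on generalizing m with
  | _ N ih =>
  by_cases hk : ∀ x y, ∀ θ ∈ Ω, ∀ θ' ∈ Ω, A θ (r x) (c y) = A θ' (r x) (c y)
  · obtain ⟨θ, hθ⟩ := hΩ
    exact ⟨θ, hθ, hfix m r c hr hc hdiag hk θ hθ⟩
  push Not at hk
  obtain ⟨a, b, θ₀, hθ₀, θ₁, hθ₁, hab⟩ := hk
  let Q : m → m → Prop := fun x y => ∃ θ ∈ Ω, A θ (r x) (c y) ≠ 0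
  -- If the non-constant entry `(a, b)` lies on a perfect matching, its complementary minor is
  -- handled by induction. Otherwise Hall's theorem gives a block triangular form with two smaller
  -- diagonal blocks.
  by_cases hg : ∃ g : {x // x ≠ a} → m, Function.Injective g ∧ ∀ x, g x ≠ b ∧ Q x (g x)
  · obtain ⟨g, hg, hgQ⟩ := hg
    let τ₀ : m → m := fun x => if h : x = a then b else g ⟨x, h⟩
    have hτ₀ : Function.Injective τ₀ := by
      intro x y hxy
      by_cases hx : x = a <;> by_cases hy : y = a
      · rw [hx, hy]
      · simp only [τ₀, hx, hy, dite_true, dite_false] at hxy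
        exact absurd hxy.symm (hgQ _).1
      · simp only [τ₀, hx, hy, dite_true, dite_false] at hxy
        exact absurd hxy (hgQ _).1
      · simp only [τ₀, hx, hy, dite_false] at hxy
        simpa using hg hxy
    let τ : Equiv.Perm m := Equiv.ofBijective τ₀ (Finite.injective_iff_bijective.mp hτ₀)
    have hτa : τ a = b := by simp [τ, τ₀]
    have hτx : ∀ x : {x // x ≠ a}, τ x = g x := fun x => by simp [τ, τ₀, x.2]
    suffices h : ∃ θ ∈ Ω, ((A θ).submatrix r (c ∘ τ)).det ≠ 0 by
      obtain ⟨θ, hθ, hdet⟩ := h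
      refine ⟨θ, hθ, fun h0 => hdet ?_⟩
      have : (A θ).submatrix r (c ∘ τ) = ((A θ).submatrix r c).submatrix id τ := rfl
      rw [this, Matrix.det_permute', h0, mul_zero]
    obtain ⟨θ, hθ, hminor⟩ := ih (Fintype.card {x // x ≠ a})
      (by rw [← hN]; exact Fintype.card_subtype_lt (x := a) (by simp))
      {x // x ≠ a} (fun x => r x) (fun x => c (τ x)) (hr.comp Subtype.val_injective)
      (hc.comp (τ.injective.comp Subtype.val_injective))
      (fun x => by rw [hτx]; exact (hgQ x).2) rfl
    obtain ⟨θ', hθ', hne⟩ : ∃ θ' ∈ Ω, A θ (r a) (c b) ≠ A θ' (r a) (c b) := by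
      by_cases h0 : A θ (r a) (c b) = A θ₀ (r a) (c b)
      · exact ⟨θ₁, hθ₁, by rwa [h0]⟩
      · exact ⟨θ₀, hθ₀, h0⟩
    obtain ⟨θ'', hθ'', hE, hE'⟩ := hind {(r a, c b)} θ hθ θ' hθ'
    have := Matrix.det_ne_zero_or_of_diag ((A θ).submatrix r (c ∘ τ))
      ((A θ'').submatrix r (c ∘ τ)) a
      (by simpa [hτa, hE (r a) (c b) rfl] using hne)
      (fun x y hxy => by
        refine (hE' _ _ fun h => hxy ?_).symm
        simp only [Set.mem_singleton_iff, Prod.mk.injEq] at h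
        rw [hr h.1, τ.injective ((hc h.2).trans hτa.symm)])
      hminor
    rcases this with h | h
    · exact ⟨θ, hθ, h⟩
    · exact ⟨θ'', hθ'', h⟩
  · obtain ⟨S, haS, hbS, hS⟩ := exists_closed_of_hall_violation Q hdiag a b hg
    obtain ⟨θ, hθ, h1⟩ := ih (Fintype.card {x // x ∈ S})
      (by rw [← hN]; exact Fintype.card_subtype_lt (x := a) haS)
      {x // x ∈ S} (fun x => r x) (fun x => c x) (hr.comp Subtype.val_injective)
      (hc.comp Subtype.val_injective) (fun x => hdiag x) rfl
    obtain ⟨θ', hθ', h2⟩ := ih (Fintype.card {x // x ∉ S})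
      (by rw [← hN]; exact Fintype.card_subtype_lt (x := b) (by simpa using hbS))
      {x // x ∉ S} (fun x => r x) (fun x => c x) (hr.comp Subtype.val_injective)
      (hc.comp Subtype.val_injective) (fun x => hdiag x) rfl
    -- The two diagonal blocks use different rows, so one parameter can reproduce the nonsingular
    -- choice of each.
    obtain ⟨θ'', hθ'', hE, hE'⟩ := hind {e | ∃ x ∈ S, e.1 = r x} θ' hθ' θ hθ
    refine ⟨θ'', hθ'', ?_⟩
    rw [Matrix.twoBlockTriangular_det' _ (fun x => x ∈ S)]
    · refine mul_ne_zero ?_ ?_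
      · convert h1 using 2
        ext x y
        exact hE _ _ ⟨x, x.2, rfl⟩
      · convert h2 using 2
        ext x y
        refine hE' _ _ ?_
        rintro ⟨z, hz, hxz⟩
        exact x.2 (hr hxz ▸ hz)
    · intro x hx y hy
      by_contra h0
      exact hS x hx y hy ⟨θ'', hθ'', h0⟩

end GenericDeterminant

/-! ### Rational parameterizations and structural rank -/

theorem Polynomial.map_eval_congr {n : ℕ} {S : Set (Fin n)}
    {p : Polynomial (MvPolynomial (Fin n) ℝ)}
    (hp : ∀ k, ((p.coeff k).vars : Set (Fin n)) ⊆ S) {θ θ' : Fin n → ℝ}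
    (h : ∀ i ∈ S, θ i = θ' i) :
    p.map (MvPolynomial.eval θ) = p.map (MvPolynomial.eval θ') := by
  ext k
  rw [Polynomial.coeff_map, Polynomial.coeff_map]
  exact MvPolynomial.eval₂Hom_congr' rfl (fun i hi _ => h i (hp k hi)) rfl

/-- If one member of a rationally parameterized family of square matrices is nonsingular, then
almost all members are. -/
theorem ae_det_ne_zero_of_exists {n : ℕ} {m : Type*} [Fintype m] [DecidableEq m]
    (p d : m → m → Polynomial (MvPolynomial (Fin n) ℝ))
    (f : (Fin n → ℝ) → Matrix m m (RatFunc ℝ))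
    (hf : ∀ θ x y, f θ x y =
      algebraMap (Polynomial ℝ) (RatFunc ℝ) ((p x y).map (MvPolynomial.eval θ)) /
        algebraMap (Polynomial ℝ) (RatFunc ℝ) ((d x y).map (MvPolynomial.eval θ)))
    (θ₀ : Fin n → ℝ) (hd₀ : ∀ x y, (d x y).map (MvPolynomial.eval θ₀) ≠ 0)
    (hdet : (f θ₀).det ≠ 0) :
    ∀ᵐ θ ∂(volume : Measure (Fin n → ℝ)),
      (∀ x y, (d x y).map (MvPolynomial.eval θ) ≠ 0) → (f θ).det ≠ 0 := by
  classical
  let φ : (Fin n → ℝ) → Polynomial (MvPolynomial (Fin n) ℝ) →+* RatFunc ℝ := fun θ =>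
    (algebraMap (Polynomial ℝ) (RatFunc ℝ)).comp (Polynomial.mapRingHom (MvPolynomial.eval θ))
  have hφ0 : ∀ θ q, Polynomial.map (MvPolynomial.eval θ) q ≠ 0 → φ θ q ≠ 0 := fun θ q hq =>
    RatFunc.algebraMap_ne_zero hq
  -- `B` is the matrix `D • f` with denominators cleared. Its determinant is a polynomial in `z`;
  -- where the leading coefficient, a nonzero polynomial in the parameters, does not vanish, `f` is
  -- nonsingular.
  let D : Polynomial (MvPolynomial (Fin n) ℝ) := ∏ e : m × m, d e.1 e.2
  let B : Matrix m m (Polynomial (MvPolynomial (Fin n) ℝ)) := Matrix.of fun x y =>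
    p x y * ∏ e ∈ Finset.univ.erase (x, y), d e.1 e.2
  have key : ∀ θ, (∀ x y, (d x y).map (MvPolynomial.eval θ) ≠ 0) →
      φ θ B.det = φ θ D ^ Fintype.card m * (f θ).det := by
    intro θ hθ
    rw [RingHom.map_det, ← Matrix.det_smul]
    congr 1
    ext1 x y
    have hne : φ θ (d x y) ≠ 0 := hφ0 θ _ (hθ x y)
    have hD : D = d x y * ∏ e ∈ Finset.univ.erase (x, y), d e.1 e.2 :=
      (Finset.mul_prod_erase Finset.univ (fun e : m × m => d e.1 e.2)
        (Finset.mem_univ (x, y))).symm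
    have hfxy : f θ x y = φ θ (p x y) / φ θ (d x y) := hf θ x y
    simp only [RingHom.mapMatrix_apply, Matrix.map_apply, Matrix.smul_apply, smul_eq_mul, B,
      Matrix.of_apply]
    rw [hfxy, hD, map_mul, map_mul]
    field_simp
  have hB : B.det ≠ 0 := by
    intro h0
    have h1 := key θ₀ hd₀
    rw [h0, map_zero] at h1
    refine mul_ne_zero (pow_ne_zero _ ?_) hdet h1.symm
    rw [map_prod]
    refine Finset.prod_ne_zero_iff.mpr fun e _ => ?_
    exact hφ0 θ₀ _ (hd₀ e.1 e.2)
  filter_upwards [MvPolynomial.ae_eval_ne_zero _ (Polynomial.leadingCoeff_ne_zero.mpr hB)]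
    with θ hθ hd h0
  have h1 := key θ hd
  rw [h0, mul_zero] at h1
  have h2 : B.det.map (MvPolynomial.eval θ) = 0 := by
    by_contra h
    exact hφ0 θ _ h h1
  apply hθ
  have := congrArg (fun f => Polynomial.coeff f B.det.natDegree) h2
  simpa using this

/-- Entries that are rationally parameterized by disjoint sets of parameters: a square selection
with a perfect matching in its pattern is nonsingular almost everywhere, provided that the
selections of constant entries with this property are nonsingular. -/
theorem ae_det_submatrix_ne_zero {n : ℕ} {ι κ : Type*} (Θ : Set (Fin n → ℝ)) (hΘ : Θ.Nonempty)
    (A : (Fin n → ℝ) → Matrix ι κ (RatFunc ℝ)) (S : ι → κ → Set (Fin n))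
    (hS : ∀ a b a' b', (a, b) ≠ (a', b') → Disjoint (S a b) (S a' b'))
    (hrat : ∀ a b, IsRationalIn Θ (S a b) (fun θ => A θ a b))
    (hfix : ∀ (m : Type) [Fintype m] [DecidableEq m] (r : m → ι) (c : m → κ),
      Function.Injective r → Function.Injective c →
      (∀ x, ∃ θ ∈ Θ, A θ (r x) (c x) ≠ 0) →
      (∀ x y, ∀ θ ∈ Θ, ∀ θ' ∈ Θ, A θ (r x) (c y) = A θ' (r x) (c y)) →
      ∀ θ ∈ Θ, ((A θ).submatrix r c).det ≠ 0)
    (m : Type) [Fintype m] [DecidableEq m] (r : m → ι) (c : m → κ)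
    (hr : Function.Injective r) (hc : Function.Injective c)
    (hdiag : ∀ x, ∃ θ ∈ Θ, A θ (r x) (c x) ≠ 0) :
    ∀ᵐ θ ∂(volume : Measure (Fin n → ℝ)), θ ∈ Θ → ((A θ).submatrix r c).det ≠ 0 := by
  classical
  choose p d hpS hdS hpd using hrat
  let f : (Fin n → ℝ) → Matrix ι κ (RatFunc ℝ) := fun θ a b =>
    algebraMap (Polynomial ℝ) (RatFunc ℝ) ((p a b).map (MvPolynomial.eval θ)) /
      algebraMap (Polynomial ℝ) (RatFunc ℝ) ((d a b).map (MvPolynomial.eval θ))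
  -- `Θ` need not be closed under mixing coordinates of two parameters. The larger set on which all
  -- denominators survive is closed under it, because the entries use disjoint sets of parameters.
  let Ω : Set (Fin n → ℝ) := {θ | ∀ a b, (d a b).map (MvPolynomial.eval θ) ≠ 0}
  have hΘΩ : Θ ⊆ Ω := fun θ hθ a b => (hpd a b θ hθ).1
  have hfA : ∀ θ ∈ Θ, ∀ a b, f θ a b = A θ a b := fun θ hθ a b => (hpd a b θ hθ).2.symm
  have hfA' : ∀ θ ∈ Θ, f θ = A θ := fun θ hθ => Matrix.ext (hfA θ hθ)
  have hind : VariesIndependently Ω f := by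
    intro E θ hθ θ' hθ'
    let θ'' : Fin n → ℝ := fun i => if ∃ e ∈ E, i ∈ S e.1 e.2 then θ' i else θ i
    have h1 : ∀ a b, (a, b) ∈ E → ∀ i ∈ S a b, θ'' i = θ' i := fun a b hab i hi =>
      if_pos ⟨(a, b), hab, hi⟩
    have h2 : ∀ a b, (a, b) ∉ E → ∀ i ∈ S a b, θ'' i = θ i := by
      intro a b hab i hi
      refine if_neg ?_
      rintro ⟨⟨a', b'⟩, he, hi'⟩
      exact Set.disjoint_left.mp (hS a b a' b' fun h => hab (h ▸ he)) hi hi'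
    refine ⟨θ'', fun a b => ?_, fun a b hab => ?_, fun a b hab => ?_⟩
    · by_cases hab : (a, b) ∈ E
      · rw [Polynomial.map_eval_congr (hdS a b) (h1 a b hab)]; exact hθ' a b
      · rw [Polynomial.map_eval_congr (hdS a b) (h2 a b hab)]; exact hθ a b
    · simp only [f]
      rw [Polynomial.map_eval_congr (hdS a b) (h1 a b hab),
        Polynomial.map_eval_congr (hpS a b) (h1 a b hab)]
    · simp only [f]
      rw [Polynomial.map_eval_congr (hdS a b) (h2 a b hab),
        Polynomial.map_eval_congr (hpS a b) (h2 a b hab)]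
  obtain ⟨θ₀, hθ₀, hdet⟩ := exists_det_submatrix_ne_zero Ω (hΘ.mono hΘΩ) f hind (by
    intro m _ _ r c hr hc hdiag hconst θ hθ
    obtain ⟨θ₁, hθ₁⟩ := hΘ
    have heq : (f θ).submatrix r c = (A θ₁).submatrix r c := by
      ext x y
      rw [← hfA' θ₁ hθ₁]
      exact hconst x y θ hθ θ₁ (hΘΩ hθ₁)
    rw [heq]
    refine hfix m r c hr hc (fun x => ?_) (fun x y θ' hθ' θ'' hθ'' => ?_) θ₁ hθ₁
    · obtain ⟨θ₂, hθ₂, h⟩ := hdiag x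
      refine ⟨θ₁, hθ₁, ?_⟩
      rwa [← hfA θ₁ hθ₁, ← hconst x x θ₂ hθ₂ θ₁ (hΘΩ hθ₁)]
    · rw [← hfA θ' hθ', ← hfA θ'' hθ'']
      exact hconst x y θ' (hΘΩ hθ') θ'' (hΘΩ hθ'')) m r c hr hc (fun x => by
    obtain ⟨θ, hθ, h⟩ := hdiag x
    exact ⟨θ, hΘΩ hθ, by rwa [hfA θ hθ]⟩)
  filter_upwards [ae_det_ne_zero_of_exists (fun x y => p (r x) (c y)) (fun x y => d (r x) (c y))
    (fun θ => (f θ).submatrix r c) (fun θ x y => rfl) θ₀ (fun x y => hθ₀ _ _) hdet] with θ h hθ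
  rw [← hfA' θ hθ]
  exact h fun x y => hΘΩ hθ _ _

/-- Put `t` on the matching and `1` at all other nonzero places. After reindexing along the matching
this is `t I - N`, so any nonzero `t` that is not an eigenvalue of `N` gives a nonsingular matrix
with the same pattern. -/
theorem card_le_structuralRank {ι κ F : Type*} [Fintype κ] [Field F] [Infinite F]
    (A : Matrix ι κ F) (e : ι ≃ κ) (he : ∀ i, A i (e i) ≠ 0) :
    Fintype.card κ ≤ structuralRank A := by
  classical
  have : Fintype ι := Fintype.ofEquiv κ e.symm
  let N : Matrix ι ι F := Matrix.of fun i j => if A i (e j) = 0 ∨ i = j then 0 else -1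
  obtain ⟨t, ht⟩ : ∃ t : F, (N.charpoly * Polynomial.X).eval t ≠ 0 := by
    by_contra! h
    exact mul_ne_zero N.charpoly_monic.ne_zero Polynomial.X_ne_zero
      (Polynomial.funext (by simpa using h))
  simp only [Polynomial.eval_mul, Polynomial.eval_X, mul_ne_zero_iff] at ht
  let B : Matrix ι κ F := Matrix.of fun i k => if A i k = 0 then 0 else if k = e i then t else 1
  have hB : B.submatrix id e = Matrix.scalar ι t - N := by
    ext i j
    by_cases hij : i = j
    · subst hij
      simp [B, N, he]
    · have : ¬ j = i := fun h => hij h.symm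
      by_cases hA : A i (e j) = 0 <;> simp [B, N, hA, hij, this]
  have hrank : B.rank = Fintype.card κ := by
    have h1 : (B.submatrix id e).rank = B.rank := Matrix.rank_submatrix B (Equiv.refl ι) e
    rw [← h1, hB, Matrix.rank_of_isUnit, Fintype.card_congr e]
    rw [Matrix.isUnit_iff_isUnit_det, ← Matrix.eval_charpoly]
    exact ht.1.isUnit
  refine le_csSup ⟨Fintype.card κ, ?_⟩ ⟨B, fun a b => ?_, hrank⟩
  · rintro k ⟨B, -, rfl⟩
    exact Matrix.rank_le_card_width B
  · by_cases hA : A a b = 0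
    · simp [B, hA]
    · by_cases hb : b = e a <;> simp [B, hA, hb, ht.2]

namespace NetworkModelSet

variable {L K n : ℕ} (M : NetworkModelSet L K n)

/-- The matrix `[G - I  X]`. -/
def incidence (θ : Fin n → ℝ) : Matrix (Fin L) M.Vertex (RatFunc ℝ) :=
  Matrix.fromCols (M.G θ - 1) (M.X θ)

/-- A perfect matching makes the structural rank full, and a constant submatrix attains its
structural rank. This is the base case for the generic determinant. -/
theorem FixedEntriesRegular.det_ne_zero {M : NetworkModelSet L K n} (hFixed : M.FixedEntriesRegular)
    (m : Type) [Fintype m] [DecidableEq m] (r : m → Fin L) (c : m → M.Vertex)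
    (hr : Function.Injective r) (hc : Function.Injective c)
    (hdiag : ∀ x, ∃ θ ∈ M.Θ, M.incidence θ (r x) (c x) ≠ 0)
    (hconst : ∀ x y, ∀ θ ∈ M.Θ, ∀ θ' ∈ M.Θ,
      M.incidence θ (r x) (c y) = M.incidence θ' (r x) (c y)) :
    ∀ θ ∈ M.Θ, ((M.incidence θ).submatrix r c).det ≠ 0 := by
  classical
  intro θ hθ
  let rows : Finset (Fin L) := Finset.univ.image r
  let cols : Finset M.Vertex := Finset.univ.image c
  let er : m ≃ rows := Equiv.ofBijective (fun x => ⟨r x, by simp [rows]⟩)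
    ⟨fun x y h => hr (Subtype.ext_iff.mp h), fun ⟨u, hu⟩ => by
      obtain ⟨x, -, rfl⟩ := Finset.mem_image.mp hu
      exact ⟨x, rfl⟩⟩
  let ec : m ≃ cols := Equiv.ofBijective (fun x => ⟨c x, by simp [cols]⟩)
    ⟨fun x y h => hc (Subtype.ext_iff.mp h), fun ⟨u, hu⟩ => by
      obtain ⟨x, -, rfl⟩ := Finset.mem_image.mp hu
      exact ⟨x, rfl⟩⟩
  have hrank := hFixed rows cols (by
    intro θ₀ hθ₀ θ₁ hθ₁
    ext ⟨u, hu⟩ ⟨v, hv⟩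
    obtain ⟨x, -, rfl⟩ := Finset.mem_image.mp hu
    obtain ⟨y, -, rfl⟩ := Finset.mem_image.mp hv
    exact hconst x y θ₀ hθ₀ θ₁ hθ₁) θ hθ
  have hle := card_le_structuralRank ((M.incidence θ).submatrix
    (Subtype.val : rows → Fin L) (Subtype.val : cols → M.Vertex)) (er.symm.trans ec) (by
      intro u
      obtain ⟨x, rfl⟩ := er.surjective u
      obtain ⟨θ', hθ', h⟩ := hdiag x
      rw [hconst x x θ' hθ' θ hθ] at h
      rw [Equiv.trans_apply, Equiv.symm_apply_apply]
      exact h)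
  have h1 : ((M.incidence θ).submatrix r c).rank = ((M.incidence θ).submatrix
      (Subtype.val : rows → Fin L) (Subtype.val : cols → M.Vertex)).rank :=
    Matrix.rank_submatrix ((M.incidence θ).submatrix
      (Subtype.val : rows → Fin L) (Subtype.val : cols → M.Vertex)) er ec
  have h2 : Fintype.card m ≤ ((M.incidence θ).submatrix r c).rank := by
    rw [h1, Fintype.card_congr ec]
    exact hle.trans hrank.ge
  intro h0
  have h3 : LinearIndependent (RatFunc ℝ) ((M.incidence θ).submatrix r c).col := by
    rw [linearIndependent_iff_card_eq_finrank_span, Set.finrank, ← Matrix.rank_eq_finrank_span_cols]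
    exact le_antisymm h2 (Matrix.rank_le_card_width _)
  rw [Matrix.linearIndependent_cols_iff_isUnit, Matrix.isUnit_iff_isUnit_det, h0] at h3
  exact not_isUnit_zero h3

end NetworkModelSet

/-! ### Disjoint paths, permutations and matchings -/

section DisjointPaths

variable {V : Type*} (E : V → V → Prop) {k : ℕ}

/-- A permutation of the vertices together with `k` extra points, which away from the extra points
moves vertices only against edges, decomposes into `k` disjoint paths. -/
theorem exists_disjoint_paths_of_perm [Finite V] (σ : Equiv.Perm (V ⊕ Fin k)) (v c : Fin k → V)
    (h1 : ∀ u w, σ (Sum.inl u) = Sum.inl w → u ≠ w → E w u)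
    (h2 : ∀ u b, σ (Sum.inl u) = Sum.inr b → u = v b)
    (h3 : ∀ a, σ (Sum.inr a) = Sum.inl (c a)) :
    ∃ p : Fin k → List V, (∀ a, (p a).IsChain E ∧ (p a).Nodup ∧
      (∃ b, (p a).head? = some (v b)) ∧ (p a).getLast? = some (c a)) ∧
      ∀ a b, a ≠ b → (p a).Disjoint (p b) := by
  classical
  -- The orbit of an extra point is followed until it first meets an extra point again. The vertices
  -- in between, read backwards, form a path because `σ` moves against the edges.
  have hret : ∀ a : Fin k, ∃ m, 0 < m ∧ ((σ ^ m) (Sum.inr a)).isRight := fun a =>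
    ⟨orderOf σ, orderOf_pos σ, by simp [pow_orderOf_eq_one]⟩
  let m : Fin k → ℕ := fun a => Nat.find (hret a)
  have hm0 : ∀ a, 0 < m a := fun a => (Nat.find_spec (hret a)).1
  have hmR : ∀ a, ((σ ^ m a) (Sum.inr a)).isRight := fun a => (Nat.find_spec (hret a)).2
  have hlt : ∀ a i, 0 < i → i < m a → ∃ u, (σ ^ i) (Sum.inr a) = Sum.inl u := by
    intro a i hi him
    have := Nat.find_min (hret a) him
    rcases h : (σ ^ i) (Sum.inr a) with u | b
    · exact ⟨u, rfl⟩
    · exact absurd ⟨hi, by simp [h]⟩ this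
  have hm1 : ∀ a, 2 ≤ m a := by
    intro a
    by_contra hlt'
    have h1' : m a = 1 := by have := hm0 a; omega
    have := hmR a
    rw [h1', pow_one, h3] at this
    simp at this
  let u : Fin k → ℕ → V := fun a i => Sum.elim id c ((σ ^ i) (Sum.inr a))
  have hu : ∀ a i, 0 < i → i < m a → (σ ^ i) (Sum.inr a) = Sum.inl (u a i) := by
    intro a i hi him
    obtain ⟨w, hw⟩ := hlt a i hi him
    simp [u, hw]
  have hinj' : ∀ a b i j, 0 < i → i ≤ j → i < m a → j < m b → u a i = u b j → a = b ∧ i = j := by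
    intro a b i j hi hij hia hjb h
    -- Cancelling `σ ^ i` turns a coincidence at different times into a return to an extra point
    -- before the first one.
    have e : (σ ^ i) (Sum.inr a) = (σ ^ i) ((σ ^ (j - i)) (Sum.inr b)) := by
      rw [← Equiv.Perm.mul_apply, ← pow_add, Nat.add_sub_cancel' hij, hu a i hi hia,
        hu b j (hi.trans_le hij) hjb, h]
    have e' := (σ ^ i).injective e
    rcases Nat.eq_zero_or_pos (j - i) with h0 | h0
    · rw [h0] at e'
      exact ⟨by simpa using e', by omega⟩
    · rw [hu b (j - i) h0 (by omega)] at e'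
      simp at e'
  have hinj : ∀ a b i j, 0 < i → 0 < j → i < m a → j < m b → u a i = u b j → a = b ∧ i = j := by
    intro a b i j hi hj hia hjb h
    rcases le_total i j with hij | hij
    · exact hinj' a b i j hi hij hia hjb h
    · obtain ⟨h1, h2⟩ := hinj' b a j i hj hij hjb hia h.symm
      exact ⟨h1.symm, h2.symm⟩
  let p : Fin k → List V := fun a => List.ofFn fun i : Fin (m a - 1) => u a (m a - 1 - i)
  have hlen : ∀ a, (p a).length = m a - 1 := fun a => by simp [p]
  have hget : ∀ a i (h : i < (p a).length), (p a)[i] = u a (m a - 1 - i) := fun a i h => by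
    simp [p]
  refine ⟨p, fun a => ⟨?_, ?_, ?_, ?_⟩, ?_⟩
  · rw [List.isChain_iff_getElem]
    intro i hi
    rw [hget, hget]
    rw [hlen] at hi
    have hs : m a - 1 - i = (m a - 1 - (i + 1)) + 1 := by omega
    set q := m a - 1 - (i + 1) with hq
    rw [hs]
    apply h1
    · rw [← hu a q (by omega) (by omega), ← hu a (q + 1) (by omega) (by omega), pow_succ',
        Equiv.Perm.mul_apply]
    · intro h
      have := (hinj a a q (q + 1) (by omega) (by omega) (by omega) (by omega) h).2
      omega
  · rw [List.nodup_iff_injective_getElem]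
    rintro ⟨i, hi⟩ ⟨j, hj⟩ h
    simp only [hget] at h
    rw [hlen] at hi hj
    have := (hinj a a _ _ (by omega) (by omega) (by omega) (by omega) h).2
    simp only [Fin.mk.injEq]
    omega
  · have h2m := hm1 a
    obtain ⟨b, hb⟩ := Sum.isRight_iff.mp (hmR a)
    refine ⟨b, ?_⟩
    rw [List.head?_eq_getElem?, List.getElem?_eq_getElem (by rw [hlen]; omega), hget]
    congr 1
    apply h2
    rw [← hu a _ (by omega) (by omega), ← hb, ← Equiv.Perm.mul_apply, ← pow_succ']
    congr 2
    omega
  · have h2m := hm1 a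
    rw [List.getLast?_eq_getElem?, List.getElem?_eq_getElem (by rw [hlen]; omega), hget, hlen]
    congr 1
    have : m a - 1 - (m a - 1 - 1) = 1 := by omega
    rw [this]
    simp [u, h3]
  · intro a b hab x hxa hxb
    obtain ⟨i, hi, rfl⟩ := List.mem_iff_getElem.mp hxa
    obtain ⟨j, hj, h⟩ := List.mem_iff_getElem.mp hxb
    rw [hget, hget] at h
    rw [hlen] at hi hj
    exact hab (hinj b a _ _ (by omega) (by omega) (by omega) (by omega) h).1.symm

/-- Disjoint paths give an injective assignment `c` of tails to the vertices that start no path: a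
vertex is assigned its predecessor, or itself if it lies on no path. -/
theorem exists_matching_of_disjoint_paths (p : Fin k → List V)
    (hchain : ∀ a, (p a).IsChain E) (hnodup : ∀ a, (p a).Nodup)
    (hdisj : ∀ a b, a ≠ b → (p a).Disjoint (p b)) :
    ∃ c : V → V,
      (∀ u, (∀ a, (p a).head? ≠ some u) → c u = u ∨ E (c u) u) ∧
      Set.InjOn c {u | ∀ a, (p a).head? ≠ some u} ∧
      ∀ w, (∀ a, (p a).getLast? ≠ some w) →
        ∃ u, (∀ a, (p a).head? ≠ some u) ∧ c u = w ∧ (u = w ∨ E w u) := by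
  classical
  have hpos : ∀ (a b : Fin k) (i j : ℕ) (u : V), (p a)[i]? = some u → (p b)[j]? = some u → a = b ∧ i = j := by
    intro a b i j u hi hj
    have hab : a = b := by
      by_contra h
      exact hdisj a b h (List.mem_of_getElem? hi) (List.mem_of_getElem? hj)
    subst hab
    obtain ⟨hi', hi⟩ := List.getElem?_eq_some_iff.mp hi
    obtain ⟨hj', hj⟩ := List.getElem?_eq_some_iff.mp hj
    exact ⟨rfl, (hnodup a).getElem_inj_iff.mp (hi.trans hj.symm)⟩
  let Pred : V → V → Prop := fun u w => ∃ a i, (p a)[i]? = some w ∧ (p a)[i + 1]? = some u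
  have hPE : ∀ u w, Pred u w → E w u := by
    rintro u w ⟨a, i, hw, hu⟩
    obtain ⟨hi', rfl⟩ := List.getElem?_eq_some_iff.mp hw
    obtain ⟨hj', rfl⟩ := List.getElem?_eq_some_iff.mp hu
    exact List.isChain_iff_getElem.mp (hchain a) i hj'
  let c : V → V := fun u => if h : ∃ w, Pred u w then h.choose else u
  have hc1 : ∀ u w, Pred u w → c u = w := by
    intro u w h
    have hex : ∃ w, Pred u w := ⟨w, h⟩
    have hcu : c u = hex.choose := dif_pos hex
    obtain ⟨a, i, h1, h2⟩ := h
    obtain ⟨b, j, h3, h4⟩ := hex.choose_spec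
    obtain ⟨rfl, hij⟩ := hpos _ _ _ _ _ h2 h4
    obtain rfl : i = j := by omega
    rw [hcu]
    exact Option.some_injective _ (h3.symm.trans h1)
  have hc0 : ∀ u, (¬ ∃ w, Pred u w) → c u = u := fun u h => dif_neg h
  have hoff : ∀ u, (∀ a, (p a).head? ≠ some u) → (¬ ∃ w, Pred u w) → ∀ a, u ∉ p a := by
    intro u hu h a ha
    obtain ⟨i, hi⟩ := List.mem_iff_getElem?.mp ha
    rcases i with _ | i
    · exact hu a (by rw [List.head?_eq_getElem?]; exact hi)
    · obtain ⟨hi', -⟩ := List.getElem?_eq_some_iff.mp hi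
      exact h ⟨(p a)[i], a, i, List.getElem?_eq_getElem (by omega), hi⟩
  refine ⟨c, fun u hu => ?_, ?_, fun w hw => ?_⟩
  · by_cases h : ∃ w, Pred u w
    · obtain ⟨w, h⟩ := h
      exact Or.inr (hc1 u w h ▸ hPE u w h)
    · exact Or.inl (hc0 u h)
  · intro u hu u' hu' huu'
    by_cases h : ∃ w, Pred u w <;> by_cases h' : ∃ w, Pred u' w
    · obtain ⟨w, h⟩ := h
      obtain ⟨w', h'⟩ := h'
      rw [hc1 u w h, hc1 u' w' h'] at huu'
      subst huu'
      obtain ⟨a, i, h1, h2⟩ := h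
      obtain ⟨b, j, h3, h4⟩ := h'
      obtain ⟨rfl, rfl⟩ := hpos _ _ _ _ _ h1 h3
      exact Option.some_injective _ (h2.symm.trans h4)
    · obtain ⟨w, h⟩ := h
      rw [hc1 u w h, hc0 u' h'] at huu'
      subst huu'
      obtain ⟨a, i, h1, h2⟩ := h
      exact absurd (List.mem_of_getElem? h1) (hoff _ hu' h' a)
    · obtain ⟨w, h'⟩ := h'
      rw [hc1 u' w h', hc0 u h] at huu'
      subst huu'
      obtain ⟨a, i, h1, h2⟩ := h'
      exact absurd (List.mem_of_getElem? h1) (hoff _ hu h a)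
    · rwa [hc0 u h, hc0 u' h'] at huu'
  · by_cases hon : ∃ a, w ∈ p a
    · obtain ⟨a, ha⟩ := hon
      obtain ⟨i, hi⟩ := List.mem_iff_getElem?.mp ha
      obtain ⟨hi', hiw⟩ := List.getElem?_eq_some_iff.mp hi
      have hi1 : i + 1 < (p a).length := by
        by_contra hlt
        refine hw a ?_
        rw [List.getLast?_eq_getElem?, ← hi]
        congr 1
        omega
      have hP : Pred (p a)[i + 1] w := ⟨a, i, hi, List.getElem?_eq_getElem hi1⟩
      refine ⟨_, fun b hb => ?_, hc1 _ _ hP, Or.inr (hPE _ _ hP)⟩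
      rw [List.head?_eq_getElem?] at hb
      have := (hpos _ _ _ _ _ hb (List.getElem?_eq_getElem hi1)).2
      omega
    · push Not at hon
      have hP : ¬ ∃ w', Pred w w' := by
        rintro ⟨w', a, i, -, h⟩
        exact hon a (List.mem_of_getElem? h)
      refine ⟨w, fun a ha => ?_, hc0 w hP, Or.inl rfl⟩
      exact hon a (List.mem_of_head? ha)

end DisjointPaths

/-! ### Matrix operations compatible with evaluation -/

section EntrywiseSubring

variable {F E ι κ μ : Type*}

/-- Two matrices are related entrywise by a relation. -/
def EntriesIn [Ring F] [Ring E] (R : Subring (F × E)) (A : Matrix ι κ F) (B : Matrix ι κ E) :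
    Prop := ∀ i j, (A i j, B i j) ∈ R

theorem EntriesIn.mul [Ring F] [Ring E] {R : Subring (F × E)} [Fintype κ] {A : Matrix ι κ F}
    {B : Matrix ι κ E} {A' : Matrix κ μ F} {B' : Matrix κ μ E} (h : EntriesIn R A B)
    (h' : EntriesIn R A' B') : EntriesIn R (A * A') (B * B') := by
  intro i j
  have : ((A * A') i j, (B * B') i j) = ∑ k, (A i k, B i k) * (A' k j, B' k j) := by
    simp [Matrix.mul_apply, Prod.ext_iff, Prod.fst_sum, Prod.snd_sum]
  rw [this]
  exact R.sum_mem fun k _ => R.mul_mem (h i k) (h' k j)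

theorem EntriesIn.one [Ring F] [Ring E] {R : Subring (F × E)} [DecidableEq ι] :
    EntriesIn R (1 : Matrix ι ι F) (1 : Matrix ι ι E) := by
  intro i j
  by_cases h : i = j
  · subst h
    rw [Matrix.one_apply_eq, Matrix.one_apply_eq]
    exact R.one_mem
  · rw [Matrix.one_apply_ne h, Matrix.one_apply_ne h]
    exact R.zero_mem

theorem EntriesIn.sub [Ring F] [Ring E] {R : Subring (F × E)} {A A' : Matrix ι κ F}
    {B B' : Matrix ι κ E} (h : EntriesIn R A B) (h' : EntriesIn R A' B') :
    EntriesIn R (A - A') (B - B') := fun i j => R.sub_mem (h i j) (h' i j)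

theorem EntriesIn.submatrix [Ring F] [Ring E] {R : Subring (F × E)} {A : Matrix ι κ F}
    {B : Matrix ι κ E} {ι' κ' : Type*} (h : EntriesIn R A B) (e : ι' → ι) (f : κ' → κ) :
    EntriesIn R (A.submatrix e f) (B.submatrix e f) := fun i j => h (e i) (f j)

/-- Determinant and adjugate commute with ring homomorphisms, so they can be formed over `R` and
projected to both factors. -/
theorem EntriesIn.det_adjugate [CommRing F] [CommRing E] {R : Subring (F × E)} [Fintype ι]
    [DecidableEq ι] {A : Matrix ι ι F} {B : Matrix ι ι E} (h : EntriesIn R A B) :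
    (A.det, B.det) ∈ R ∧ EntriesIn R A.adjugate B.adjugate := by
  let D : Matrix ι ι R := Matrix.of fun i j => ⟨(A i j, B i j), h i j⟩
  let φ : R →+* F := (RingHom.fst F E).comp R.subtype
  let ψ : R →+* E := (RingHom.snd F E).comp R.subtype
  have hA : φ.mapMatrix D = A := by ext i j; rfl
  have hB : ψ.mapMatrix D = B := by ext i j; rfl
  have hmem : ∀ x : R, (φ x, ψ x) ∈ R := fun x => x.2
  constructor
  · rw [← hA, ← hB, ← RingHom.map_det, ← RingHom.map_det]
    exact hmem _
  · intro i j
    rw [← hA, ← hB, ← RingHom.map_adjugate, ← RingHom.map_adjugate]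
    exact hmem _

/-- The condition `hR` says that a function with nonzero value is a unit of `R`. Cramer's rule then
keeps the inverse in `R`. -/
theorem EntriesIn.inv [Field F] [Field E] {R : Subring (F × E)}
    (hR : ∀ f v, (f, v) ∈ R → v ≠ 0 → f ≠ 0 ∧ (f⁻¹, v⁻¹) ∈ R) [Fintype ι]
    [DecidableEq ι] {A : Matrix ι ι F} {B : Matrix ι ι E} (h : EntriesIn R A B)
    (hB : B.det ≠ 0) : A.det ≠ 0 ∧ EntriesIn R A⁻¹ B⁻¹ := by
  obtain ⟨h0, h1⟩ := hR _ _ h.det_adjugate.1 hB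
  refine ⟨h0, fun i j => ?_⟩
  rw [Matrix.inv_def, Matrix.inv_def, Ring.inverse_eq_inv', Ring.inverse_eq_inv']
  exact R.mul_mem h1 (h.det_adjugate.2 i j)

end EntrywiseSubring

/-! ### Evaluation at finite points and at infinity -/

section Places

/-- The pairs of a transfer function without pole at `z` and its value at `z`. -/
def placeAt (z : ℂ) : Subring (RatFunc ℝ × ℂ) where
  carrier := {f | f.1.denom.eval₂ (algebraMap ℝ ℂ) z ≠ 0 ∧ f.1.eval (algebraMap ℝ ℂ) z = f.2}
  mul_mem' := by
    rintro ⟨f, v⟩ ⟨g, w⟩ ⟨hf, hv : RatFunc.eval (algebraMap ℝ ℂ) z f = v⟩ ⟨hg, hw : RatFunc.eval (algebraMap ℝ ℂ) z g = w⟩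
    subst hv hw
    refine ⟨fun h => ?_, RatFunc.eval_mul _ _ hf hg⟩
    have := Polynomial.eval₂_eq_zero_of_dvd_of_eval₂_eq_zero (algebraMap ℝ ℂ) z
      (RatFunc.denom_mul_dvd f g) h
    rw [Polynomial.eval₂_mul] at this
    exact mul_ne_zero hf hg this
  one_mem' := by simp
  add_mem' := by
    rintro ⟨f, v⟩ ⟨g, w⟩ ⟨hf, hv : RatFunc.eval (algebraMap ℝ ℂ) z f = v⟩ ⟨hg, hw : RatFunc.eval (algebraMap ℝ ℂ) z g = w⟩
    subst hv hw
    refine ⟨fun h => ?_, RatFunc.eval_add _ _ hf hg⟩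
    have := Polynomial.eval₂_eq_zero_of_dvd_of_eval₂_eq_zero (algebraMap ℝ ℂ) z
      (RatFunc.denom_add_dvd f g) h
    rw [Polynomial.eval₂_mul] at this
    exact mul_ne_zero hf hg this
  zero_mem' := by simp
  neg_mem' := by
    rintro ⟨f, v⟩ ⟨hf, hv : RatFunc.eval (algebraMap ℝ ℂ) z f = v⟩
    subst hv
    have e : -f = RatFunc.C (-1) * f := by simp
    have hC : (RatFunc.C (-1) : RatFunc ℝ).denom.eval₂ (algebraMap ℝ ℂ) z ≠ 0 := by
      rw [RatFunc.denom_C]; simp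
    show (-f).denom.eval₂ (algebraMap ℝ ℂ) z ≠ 0 ∧ (-f).eval (algebraMap ℝ ℂ) z = _
    rw [e]
    refine ⟨fun h => ?_, ?_⟩
    · have := Polynomial.eval₂_eq_zero_of_dvd_of_eval₂_eq_zero (algebraMap ℝ ℂ) z
        (RatFunc.denom_mul_dvd _ f) h
      rw [Polynomial.eval₂_mul] at this
      exact mul_ne_zero hC hf this
    · rw [RatFunc.eval_mul _ _ hC hf, RatFunc.eval_C]
      simp

theorem mem_placeAt {z : ℂ} {f : RatFunc ℝ} {v : ℂ} : (f, v) ∈ placeAt z ↔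
    f.denom.eval₂ (algebraMap ℝ ℂ) z ≠ 0 ∧ f.eval (algebraMap ℝ ℂ) z = v := Iff.rfl

theorem C_mem_placeAt (z : ℂ) (a : ℝ) : (RatFunc.C a, (a : ℂ)) ∈ placeAt z := by
  rw [mem_placeAt]
  simp

/-- Properness refers to the reduced fraction. Cross-multiplication shows that any fraction
representing the function decides it. -/
theorem isProperTF_div {p q : Polynomial ℝ} (hq : q ≠ 0) (h : p.degree ≤ q.degree) :
    IsProperTF (algebraMap _ (RatFunc ℝ) p / algebraMap _ (RatFunc ℝ) q) := by
  set f := algebraMap _ (RatFunc ℝ) p / algebraMap _ (RatFunc ℝ) q with hf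
  have e := congrArg Polynomial.degree ((RatFunc.num_mul_eq_mul_denom_iff hq).mpr hf)
  rw [Polynomial.degree_mul, Polynomial.degree_mul] at e
  have : f.num.degree + q.degree ≤ f.denom.degree + q.degree := by
    rw [e, add_comm]
    gcongr
  exact (WithBot.add_le_add_iff_right (Polynomial.degree_eq_bot.not.mpr hq)).mp this

theorem valueAtInfinity_div {p q : Polynomial ℝ} (hq : q ≠ 0) (h : p.degree ≤ q.degree) :
    valueAtInfinity (algebraMap _ (RatFunc ℝ) p / algebraMap _ (RatFunc ℝ) q) =
      p.coeff q.natDegree / q.leadingCoeff := by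
  have hp := isProperTF_div hq h
  set f := algebraMap _ (RatFunc ℝ) p / algebraMap _ (RatFunc ℝ) q with hf
  have e := congrArg (fun P => Polynomial.coeff P (f.denom.natDegree + q.natDegree))
    ((RatFunc.num_mul_eq_mul_denom_iff hq).mpr hf)
  rw [Polynomial.coeff_mul_add_eq_of_natDegree_le (Polynomial.natDegree_le_natDegree hp) le_rfl,
    add_comm, Polynomial.coeff_mul_add_eq_of_natDegree_le
      (Polynomial.natDegree_le_natDegree h) le_rfl] at e
  rw [eq_div_iff (Polynomial.leadingCoeff_ne_zero.mpr hq)]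
  rw [Polynomial.coeff_natDegree, Polynomial.coeff_natDegree,
    (RatFunc.monic_denom f).leadingCoeff, mul_one] at e
  exact e

theorem isProperTF_C (a : ℝ) : IsProperTF (RatFunc.C a) := by
  unfold IsProperTF
  simpa using Polynomial.degree_C_le

theorem valueAtInfinity_C (a : ℝ) : valueAtInfinity (RatFunc.C a) = a := by
  simp [valueAtInfinity]

theorem IsProperTF.mul {f g : RatFunc ℝ} (hf : IsProperTF f) (hg : IsProperTF g) :
    IsProperTF (f * g) ∧ valueAtInfinity (f * g) = valueAtInfinity f * valueAtInfinity g := by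
  have hq := mul_ne_zero f.denom_ne_zero g.denom_ne_zero
  have hd : (f.num * g.num).degree ≤ (f.denom * g.denom).degree := by
    rw [Polynomial.degree_mul, Polynomial.degree_mul]
    exact add_le_add hf hg
  have e : f * g = algebraMap _ (RatFunc ℝ) (f.num * g.num) /
      algebraMap _ (RatFunc ℝ) (f.denom * g.denom) := by
    rw [map_mul, map_mul, mul_div_mul_comm, RatFunc.num_div_denom, RatFunc.num_div_denom]
  rw [e]
  refine ⟨isProperTF_div hq hd, ?_⟩
  rw [valueAtInfinity_div hq hd, Polynomial.natDegree_mul f.denom_ne_zero g.denom_ne_zero,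
    Polynomial.coeff_mul_add_eq_of_natDegree_le (Polynomial.natDegree_le_natDegree hf)
      (Polynomial.natDegree_le_natDegree hg)]
  simp [valueAtInfinity, (RatFunc.monic_denom _).leadingCoeff]

theorem IsProperTF.add {f g : RatFunc ℝ} (hf : IsProperTF f) (hg : IsProperTF g) :
    IsProperTF (f + g) ∧ valueAtInfinity (f + g) = valueAtInfinity f + valueAtInfinity g := by
  have hq := mul_ne_zero f.denom_ne_zero g.denom_ne_zero
  have hd : (f.num * g.denom + f.denom * g.num).degree ≤ (f.denom * g.denom).degree := by
    refine (Polynomial.degree_add_le _ _).trans (max_le ?_ ?_) <;>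
      rw [Polynomial.degree_mul, Polynomial.degree_mul]
    · exact add_le_add hf le_rfl
    · exact add_le_add le_rfl hg
  have e : f + g = algebraMap _ (RatFunc ℝ) (f.num * g.denom + f.denom * g.num) /
      algebraMap _ (RatFunc ℝ) (f.denom * g.denom) := by
    rw [map_mul, map_add, map_mul, map_mul, ← div_add_div, RatFunc.num_div_denom,
      RatFunc.num_div_denom]
    · exact RatFunc.algebraMap_ne_zero f.denom_ne_zero
    · exact RatFunc.algebraMap_ne_zero g.denom_ne_zero
  rw [e]
  refine ⟨isProperTF_div hq hd, ?_⟩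
  rw [valueAtInfinity_div hq hd, Polynomial.natDegree_mul f.denom_ne_zero g.denom_ne_zero,
    Polynomial.coeff_add,
    Polynomial.coeff_mul_add_eq_of_natDegree_le (Polynomial.natDegree_le_natDegree hf) le_rfl,
    Polynomial.coeff_mul_add_eq_of_natDegree_le le_rfl (Polynomial.natDegree_le_natDegree hg)]
  simp [valueAtInfinity, (RatFunc.monic_denom _).leadingCoeff]

/-- The pairs of a proper transfer function and its value at infinity. -/
def placeInfinity : Subring (RatFunc ℝ × ℝ) where
  carrier := {f | IsProperTF f.1 ∧ valueAtInfinity f.1 = f.2}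
  mul_mem' := by
    rintro ⟨f, v⟩ ⟨g, w⟩ ⟨hf, hv : valueAtInfinity f = v⟩ ⟨hg, hw : valueAtInfinity g = w⟩
    subst hv hw
    exact hf.mul hg
  one_mem' := by
    have := isProperTF_C 1
    have h2 := valueAtInfinity_C 1
    rw [map_one] at this h2
    exact ⟨this, h2⟩
  add_mem' := by
    rintro ⟨f, v⟩ ⟨g, w⟩ ⟨hf, hv : valueAtInfinity f = v⟩ ⟨hg, hw : valueAtInfinity g = w⟩
    subst hv hw
    exact hf.add hg
  zero_mem' := by
    have := isProperTF_C 0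
    have h2 := valueAtInfinity_C 0
    rw [map_zero] at this h2
    exact ⟨this, h2⟩
  neg_mem' := by
    rintro ⟨f, v⟩ ⟨hf, hv : valueAtInfinity f = v⟩
    subst hv
    have h := (isProperTF_C (-1)).mul hf
    rw [valueAtInfinity_C] at h
    simpa using h

theorem mem_placeInfinity {f : RatFunc ℝ} {v : ℝ} : (f, v) ∈ placeInfinity ↔
    IsProperTF f ∧ valueAtInfinity f = v := Iff.rfl

/-- A nonzero value at infinity means that numerator and denominator have equal degree, which is
symmetric under inversion. -/
theorem inv_mem_placeInfinity (f : RatFunc ℝ) (v : ℝ) (h : (f, v) ∈ placeInfinity) (hv : v ≠ 0) :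
    f ≠ 0 ∧ (f⁻¹, v⁻¹) ∈ placeInfinity := by
  obtain ⟨hf, hfv : valueAtInfinity f = v⟩ := h
  subst hfv
  have hc : f.num.coeff f.denom.natDegree ≠ 0 := hv
  have hn : f.num ≠ 0 := fun h0 => hc (by rw [h0, Polynomial.coeff_zero])
  have hdeg : f.num.degree = f.denom.degree := by
    refine le_antisymm hf ?_
    rw [Polynomial.degree_eq_natDegree f.denom_ne_zero]
    exact Polynomial.le_degree_of_ne_zero hc
  have e : f⁻¹ = algebraMap _ (RatFunc ℝ) f.denom / algebraMap _ (RatFunc ℝ) f.num := by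
    conv_lhs => rw [← RatFunc.num_div_denom f, inv_div]
  refine ⟨fun h0 => hn (by rw [h0, RatFunc.num_zero]), ?_⟩
  rw [e, mem_placeInfinity]
  refine ⟨isProperTF_div hn hdeg.ge, ?_⟩
  have hnat := Polynomial.natDegree_eq_natDegree hdeg
  rw [valueAtInfinity_div hn hdeg.ge, hnat, Polynomial.coeff_natDegree,
    (RatFunc.monic_denom f).leadingCoeff, one_div]
  change f.num.leadingCoeff⁻¹ = (f.num.coeff f.denom.natDegree)⁻¹
  rw [← hnat, Polynomial.coeff_natDegree]

theorem entriesIn_placeAt {ι κ : Type*} {A : Matrix ι κ (RatFunc ℝ)} {z : ℂ}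
    (h : ∀ i j, (A i j).denom.eval₂ (algebraMap ℝ ℂ) z ≠ 0) :
    EntriesIn (placeAt z) A (A.map (RatFunc.eval (algebraMap ℝ ℂ) z)) := fun i j => ⟨h i j, rfl⟩

theorem entriesIn_placeInfinity {ι κ : Type*} {A : Matrix ι κ (RatFunc ℝ)}
    (h : ∀ i j, IsProperTF (A i j)) :
    EntriesIn placeInfinity A (A.map valueAtInfinity) := fun i j => ⟨h i j, rfl⟩

theorem EntriesIn.eval_eq {ι κ : Type*} {A : Matrix ι κ (RatFunc ℝ)} {z : ℂ} {B : Matrix ι κ ℂ}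
    (h : EntriesIn (placeAt z) A B) : A.map (RatFunc.eval (algebraMap ℝ ℂ) z) = B :=
  Matrix.ext fun i j => (h i j).2

theorem entriesIn_C_placeAt {ι κ : Type*} (A : Matrix ι κ ℝ) (z : ℂ) :
    EntriesIn (placeAt z) (A.map RatFunc.C) (A.map (algebraMap ℝ ℂ)) :=
  fun i j => C_mem_placeAt z (A i j)

theorem entriesIn_C_placeInfinity {ι κ : Type*} (A : Matrix ι κ ℝ) :
    EntriesIn placeInfinity (A.map RatFunc.C) A :=
  fun i j => ⟨isProperTF_C (A i j), valueAtInfinity_C (A i j)⟩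

end Places

/-! ### Uniqueness of spectral factors up to a constant -/

section SpectralFactor

theorem countable_setOf_exp_mem (Z : Set ℂ) (hZ : Z.Finite) :
    {ω : ℝ | Complex.exp (ω * Complex.I) ∈ Z}.Countable := by
  have : {ω : ℝ | Complex.exp (ω * Complex.I) ∈ Z} =
      ⋃ z ∈ Z, {ω : ℝ | Complex.exp (ω * Complex.I) = z} := by
    ext ω; simp
  rw [this]
  refine hZ.countable.biUnion fun z _ => ?_
  by_cases h : ∃ ω₀ : ℝ, Complex.exp (ω₀ * Complex.I) = z
  · obtain ⟨ω₀, rfl⟩ := h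
    refine (Set.countable_range fun k : ℤ => ω₀ + k * (2 * Real.pi)).mono ?_
    intro ω hω
    obtain ⟨k, hk⟩ := Complex.exp_eq_exp_iff_exists_int.mp hω
    refine ⟨k, ?_⟩
    have h2 : (ω : ℂ) * Complex.I = ((ω₀ : ℂ) + k * (2 * Real.pi)) * Complex.I := by
      rw [hk]; ring
    have h3 := mul_right_cancel₀ Complex.I_ne_zero h2
    simp only
    exact_mod_cast h3.symm
  · convert Set.countable_empty
    ext ω
    simp only [Set.mem_ofPred_eq, Set.mem_empty_iff_false, iff_false]
    exact fun hω => h ⟨ω, hω⟩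

theorem countable_setOf_eval₂_exp_eq_zero (p : Polynomial ℝ) (hp : p ≠ 0) :
    {ω : ℝ | p.eval₂ (algebraMap ℝ ℂ) (Complex.exp (ω * Complex.I)) = 0}.Countable := by
  have hp' : p.map (algebraMap ℝ ℂ) ≠ 0 := by
    rwa [Ne, Polynomial.map_eq_zero_iff (algebraMap ℝ ℂ).injective]
  refine (countable_setOf_exp_mem _ (Polynomial.finite_setOfPred_isRoot hp')).mono ?_
  intro ω hω
  simpa [Polynomial.IsRoot, Polynomial.eval_map] using hω

theorem conj_exp_mul_I (ω : ℝ) : (starRingEnd ℂ) (Complex.exp (ω * Complex.I)) =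
    (Complex.exp (ω * Complex.I))⁻¹ := by
  rw [← Complex.exp_conj, ← Complex.exp_neg]
  simp

theorem eval₂_conj (p : Polynomial ℝ) (z : ℂ) :
    p.eval₂ (algebraMap ℝ ℂ) ((starRingEnd ℂ) z) = (starRingEnd ℂ) (p.eval₂ (algebraMap ℝ ℂ) z) := by
  rw [Polynomial.hom_eval₂]
  congr 1
  ext x
  simp

/-- On the unit circle conjugation is `z ↦ z⁻¹`, so reflection expresses the conjugate of a real
polynomial by a polynomial. -/
theorem eval₂_reflect_eq (p : Polynomial ℝ) {N : ℕ} (hN : p.natDegree ≤ N) {z : ℂ} (hz : z ≠ 0) :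
    (p.reflect N).eval₂ (algebraMap ℝ ℂ) z = z ^ N * p.eval₂ (algebraMap ℝ ℂ) z⁻¹ := by
  have hz' : z⁻¹ ≠ 0 := inv_ne_zero hz
  let : Invertible z⁻¹ := invertibleOfNonzero hz'
  have h := Polynomial.eval₂_reflect_mul_pow (algebraMap ℝ ℂ) z⁻¹ N p hN
  rw [invOf_eq_inv, inv_inv] at h
  rw [← h, inv_pow]
  field_simp

/-- A rational function without poles outside the closed disc and at infinity, bounded by one on the
unit circle, whose conjugate on the circle is again of this kind, is constant. -/
theorem eq_C_of_conj_on_circle (f g : RatFunc ℝ)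
    (hf : ∀ z : ℂ, 1 < ‖z‖ → f.denom.eval₂ (algebraMap ℝ ℂ) z ≠ 0)
    (hg : ∀ z : ℂ, 1 < ‖z‖ → g.denom.eval₂ (algebraMap ℝ ℂ) z ≠ 0)
    (hfp : IsProperTF f) (hgp : IsProperTF g) (E : Set ℝ) (hE : E.Countable)
    (hfE : ∀ ω ∉ E, f.denom.eval₂ (algebraMap ℝ ℂ) (Complex.exp (ω * Complex.I)) ≠ 0)
    (hgE : ∀ ω ∉ E, g.denom.eval₂ (algebraMap ℝ ℂ) (Complex.exp (ω * Complex.I)) ≠ 0)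
    (hconj : ∀ ω ∉ E, g.eval (algebraMap ℝ ℂ) (Complex.exp (ω * Complex.I)) =
      (starRingEnd ℂ) (f.eval (algebraMap ℝ ℂ) (Complex.exp (ω * Complex.I))))
    (hbound : ∀ ω ∉ E, ‖f.eval (algebraMap ℝ ℂ) (Complex.exp (ω * Complex.I))‖ ≤ 1) :
    f = RatFunc.C (valueAtInfinity f) := by
  set p := f.num with hp
  set q := f.denom with hq
  set r := g.num with hr
  set s := g.denom with hs
  have hq0 : q ≠ 0 := f.denom_ne_zero
  have hs0 : s ≠ 0 := g.denom_ne_zero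
  have hcop : ∀ z : ℂ, q.eval₂ (algebraMap ℝ ℂ) z = 0 → p.eval₂ (algebraMap ℝ ℂ) z ≠ 0 := by
    intro z hqz hpz
    obtain ⟨a, b, hab⟩ := RatFunc.isCoprime_num_denom f
    have := congrArg (Polynomial.eval₂ (algebraMap ℝ ℂ) z) hab
    rw [Polynomial.eval₂_add, Polynomial.eval₂_mul, Polynomial.eval₂_mul, ← hp, ← hq, hqz, hpz] at this
    simp at this
  have hdense : Dense Eᶜ := hE.dense_compl ℝ
  -- By density the bound extends over `E`. A pole on the circle would then be a zero of the
  -- numerator too, contrary to coprimality.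
  have hcirc : ∀ ω : ℝ, ‖p.eval₂ (algebraMap ℝ ℂ) (Complex.exp (ω * Complex.I))‖ ≤
      ‖q.eval₂ (algebraMap ℝ ℂ) (Complex.exp (ω * Complex.I))‖ := by
    have hcont : ∀ P : Polynomial ℝ, Continuous fun ω : ℝ =>
        ‖P.eval₂ (algebraMap ℝ ℂ) (Complex.exp (ω * Complex.I))‖ := by
      intro P
      have : Continuous fun z : ℂ => P.eval₂ (algebraMap ℝ ℂ) z := by
        simp_rw [← Polynomial.eval_map]
        exact (P.map (algebraMap ℝ ℂ)).continuous
      fun_prop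
    have hclosed := isClosed_le (hcont p) (hcont q)
    intro ω
    refine hclosed.closure_subset_iff.mpr (fun ω hω => ?_) (hdense ω)
    have h1 := hbound ω hω
    have h2 := norm_pos_iff.mpr (hfE ω hω)
    rw [RatFunc.eval, norm_div, div_le_one h2] at h1
    exact h1
  set N := max p.natDegree q.natDegree with hN
  have hpN : p.natDegree ≤ N := le_max_left _ _
  have hqN : q.natDegree ≤ N := le_max_right _ _
  -- This is `g(z) = f(1/z)` with denominators cleared. It holds off a countable set of frequencies,
  -- hence identically.
  have hpoly : r * q.reflect N = s * p.reflect N := by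
    by_contra hne
    have hcount := countable_setOf_eval₂_exp_eq_zero _ (sub_ne_zero.mpr hne)
    obtain ⟨ω, hω⟩ := ((hE.union hcount).dense_compl ℝ).nonempty
    simp only [Set.compl_union, Set.mem_inter_iff, Set.mem_compl_iff, Set.mem_ofPred_eq] at hω
    apply hω.2
    set z := Complex.exp (ω * Complex.I) with hz
    have hz0 : z ≠ 0 := Complex.exp_ne_zero _
    have h1 := hconj ω hω.1
    rw [RatFunc.eval, RatFunc.eval, map_div₀, ← eval₂_conj, ← eval₂_conj, conj_exp_mul_I, ← hz,
      ← hp, ← hq, ← hr, ← hs] at h1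
    have hq' : q.eval₂ (algebraMap ℝ ℂ) z⁻¹ ≠ 0 := by
      rw [hz, ← conj_exp_mul_I, eval₂_conj]
      simpa using hfE ω hω.1
    rw [div_eq_div_iff (hgE ω hω.1) hq'] at h1
    rw [Polynomial.eval₂_sub, Polynomial.eval₂_mul, Polynomial.eval₂_mul,
      eval₂_reflect_eq p hpN hz0, eval₂_reflect_eq q hqN hz0]
    linear_combination z ^ N * h1
  -- A pole of `f` inside the disc would reflect to a pole of `g` outside it. A pole at `0` reflects
  -- to infinity, where a comparison of degrees contradicts properness of `g`.
  have hroot : ∀ z : ℂ, q.eval₂ (algebraMap ℝ ℂ) z ≠ 0 := by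
    intro z hqz
    rcases lt_trichotomy ‖z‖ 1 with hlt | heq | hgt
    · by_cases hz0 : z = 0
      · subst hz0
        have hpz := hcop 0 hqz
        have hq00 : q.coeff 0 = 0 := by simpa using hqz
        have hp00 : p.coeff 0 ≠ 0 := by
          intro h
          exact hpz (by simp [h])
        have hdp : (p.reflect N).degree = N := by
          refine le_antisymm ?_ ?_
          · refine Polynomial.degree_le_of_natDegree_le ?_
            exact Polynomial.natDegree_reflect_le.trans (max_le le_rfl hpN)
          · apply Polynomial.le_degree_of_ne_zero
            rw [Polynomial.coeff_reflect, Polynomial.revAt_le le_rfl, Nat.sub_self]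
            exact hp00
        have hdq : (q.reflect N).degree < N := by
          rw [Polynomial.degree_lt_iff_coeff_zero]
          intro m hm
          rcases hm.eq_or_lt with rfl | hm
          · rw [Polynomial.coeff_reflect, Polynomial.revAt_le le_rfl, Nat.sub_self]
            exact hq00
          · apply Polynomial.coeff_eq_zero_of_natDegree_lt
            exact (Polynomial.natDegree_reflect_le.trans (max_le le_rfl hqN)).trans_lt hm
        have hd := congrArg Polynomial.degree hpoly
        rw [Polynomial.degree_mul, Polynomial.degree_mul, hdp] at hd
        have hsd : s.degree ≠ ⊥ := Polynomial.degree_eq_bot.not.mpr hs0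
        have h1 : r.degree + (q.reflect N).degree ≤ s.degree + (q.reflect N).degree :=
          add_le_add hgp le_rfl
        have h2 : s.degree + (q.reflect N).degree < s.degree + N :=
          WithBot.add_lt_add_left hsd hdq
        exact (h1.trans_lt h2).ne hd
      · have hinv : 1 < ‖z⁻¹‖ := by
          rw [norm_inv]
          exact (one_lt_inv₀ (norm_pos_iff.mpr hz0)).mpr hlt
        have h1 := congrArg (Polynomial.eval₂ (algebraMap ℝ ℂ) z⁻¹) hpoly
        rw [Polynomial.eval₂_mul, Polynomial.eval₂_mul, eval₂_reflect_eq p hpN (inv_ne_zero hz0),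
          eval₂_reflect_eq q hqN (inv_ne_zero hz0), inv_inv, hqz, mul_zero, mul_zero] at h1
        exact mul_ne_zero (hg _ hinv)
          (mul_ne_zero (pow_ne_zero _ (inv_ne_zero hz0)) (hcop z hqz)) h1.symm
    · have hzω : Complex.exp ((Complex.arg z : ℝ) * Complex.I) = z := by
        have := Complex.norm_mul_exp_arg_mul_I z
        rwa [heq, Complex.ofReal_one, one_mul] at this
      have h1 := hcirc (Complex.arg z)
      rw [hzω, hqz, norm_zero] at h1
      exact hcop z hqz (norm_le_zero_iff.mp h1)
    · exact hf z hgt hqz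
  have hqd : q.natDegree = 0 := by
    by_contra hne
    have hd : (q.map (algebraMap ℝ ℂ)).degree ≠ 0 := by
      rw [Polynomial.degree_map, Polynomial.degree_eq_natDegree hq0]
      exact_mod_cast hne
    obtain ⟨z, hz⟩ := IsAlgClosed.exists_root _ hd
    exact hroot z (by simpa [Polynomial.IsRoot, Polynomial.eval_map] using hz)
  have hpd : p.natDegree = 0 := by
    have : p.natDegree ≤ q.natDegree := Polynomial.natDegree_le_natDegree hfp
    omega
  obtain ⟨c, hc⟩ := (RatFunc.eq_C_iff f).mpr ⟨hpd, hqd⟩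
  rw [hc, valueAtInfinity_C]

variable {ι : Type*} [Fintype ι] [DecidableEq ι]

/-- Two spectral factors of the same spectrum that are stable, minimum phase and invertible at
infinity differ by a constant right factor. -/
theorem exists_eq_mul_C_of_spectrum_eq (N₀ N₁ : Matrix ι ι (RatFunc ℝ))
    (hs₀ : ∀ a b, IsStableTF (N₀ a b)) (hs₁ : ∀ a b, IsStableTF (N₁ a b))
    (hm₀ : IsMinimumPhase N₀) (hm₁ : IsMinimumPhase N₁)
    (D₀ D₁ : Matrix ι ι ℝ) (hD₀ : EntriesIn placeInfinity N₀ D₀)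
    (hD₁ : EntriesIn placeInfinity N₁ D₁) (hd₀ : D₀.det ≠ 0) (hd₁ : D₁.det ≠ 0)
    (hspec : ∀ ω : ℝ, freqResponse N₀ ω * (freqResponse N₀ ω)ᴴ =
      freqResponse N₁ ω * (freqResponse N₁ ω)ᴴ) :
    ∃ Q : Matrix ι ι ℝ, N₀ = N₁ * Q.map RatFunc.C := by
  have stable : ∀ f : RatFunc ℝ, IsStableTF f → ∀ z : ℂ, 1 ≤ ‖z‖ →
      f.denom.eval₂ (algebraMap ℝ ℂ) z ≠ 0 := fun f hf z hz h0 =>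
    absurd (hf z h0) (not_lt.mpr hz)
  have hcirc : ∀ ω : ℝ, ‖Complex.exp (ω * Complex.I)‖ = 1 := Complex.norm_exp_ofReal_mul_I
  have hmul : ∀ (A B : Matrix ι ι (RatFunc ℝ)) (z : ℂ),
      (∀ a b, (A a b).denom.eval₂ (algebraMap ℝ ℂ) z ≠ 0) →
      (∀ a b, (B a b).denom.eval₂ (algebraMap ℝ ℂ) z ≠ 0) →
      EntriesIn (placeAt z) (A * B) (A.map (RatFunc.eval (algebraMap ℝ ℂ) z) *
        B.map (RatFunc.eval (algebraMap ℝ ℂ) z)) := fun A B z hA hB =>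
    (entriesIn_placeAt hA).mul (entriesIn_placeAt hB)
  -- Equal spectra make `U` unitary on the circle, so its inverse `U'` is its conjugate transpose
  -- there. Each entry of `U` is thus paired with an entry of `U'` as its conjugate.
  let U : Matrix ι ι (RatFunc ℝ) := N₁⁻¹ * N₀
  let U' : Matrix ι ι (RatFunc ℝ) := N₀⁻¹ * N₁
  have hUU' : U' * U = 1 := by
    simp only [U, U']
    rw [Matrix.mul_assoc, Matrix.mul_nonsing_inv_cancel_left _ _ hm₁.1,
      Matrix.nonsing_inv_mul _ hm₀.1]
  have hreg : ∀ A B : Matrix ι ι (RatFunc ℝ), IsMinimumPhase A → (∀ a b, IsStableTF (B a b)) →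
      ∀ z : ℂ, 1 < ‖z‖ → ∀ a b, ((A⁻¹ * B) a b).denom.eval₂ (algebraMap ℝ ℂ) z ≠ 0 := by
    intro A B hA hB z hz a b
    exact (hmul A⁻¹ B z (fun a b h => absurd (hA.2 a b z h) (not_le.mpr hz))
      (fun a b => stable _ (hB a b) z hz.le) a b).1
  have hprop : ∀ A B : Matrix ι ι (RatFunc ℝ), ∀ D D' : Matrix ι ι ℝ,
      EntriesIn placeInfinity A D → D.det ≠ 0 → EntriesIn placeInfinity B D' →
      ∀ a b, IsProperTF ((A⁻¹ * B) a b) := fun A B D D' hA hD hB a b =>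
    (((hA.inv inv_mem_placeInfinity hD).2.mul hB) a b).1
  -- Minimum phase allows the inverses to have poles on the circle itself. These frequencies are set
  -- aside.
  let E : Set ℝ := ⋃ e : ι × ι,
    ({ω | (N₁⁻¹ e.1 e.2).denom.eval₂ (algebraMap ℝ ℂ) (Complex.exp (ω * Complex.I)) = 0} ∪
      {ω | (N₀⁻¹ e.1 e.2).denom.eval₂ (algebraMap ℝ ℂ) (Complex.exp (ω * Complex.I)) = 0})
  have hE : E.Countable := Set.countable_iUnion fun e =>
    (countable_setOf_eval₂_exp_eq_zero _ (RatFunc.denom_ne_zero _)).union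
      (countable_setOf_eval₂_exp_eq_zero _ (RatFunc.denom_ne_zero _))
  have hE₁ : ∀ ω ∉ E, ∀ a b,
      (N₁⁻¹ a b).denom.eval₂ (algebraMap ℝ ℂ) (Complex.exp (ω * Complex.I)) ≠ 0 :=
    fun ω hω a b h => hω (Set.mem_iUnion.mpr ⟨(a, b), Or.inl h⟩)
  have hE₀ : ∀ ω ∉ E, ∀ a b,
      (N₀⁻¹ a b).denom.eval₂ (algebraMap ℝ ℂ) (Complex.exp (ω * Complex.I)) ≠ 0 :=
    fun ω hω a b h => hω (Set.mem_iUnion.mpr ⟨(a, b), Or.inr h⟩)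
  have hU : ∀ ω ∉ E, EntriesIn (placeAt (Complex.exp (ω * Complex.I))) U
      (freqResponse N₁⁻¹ ω * freqResponse N₀ ω) := fun ω hω =>
    hmul _ _ _ (hE₁ ω hω) fun a b => stable _ (hs₀ a b) _ (hcirc ω).ge
  have hU' : ∀ ω ∉ E, EntriesIn (placeAt (Complex.exp (ω * Complex.I))) U'
      (freqResponse N₀⁻¹ ω * freqResponse N₁ ω) := fun ω hω =>
    hmul _ _ _ (hE₀ ω hω) fun a b => stable _ (hs₁ a b) _ (hcirc ω).ge
  have hunit : ∀ ω ∉ E, freqResponse U ω * (freqResponse U ω)ᴴ = 1 := by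
    intro ω hω
    have h1 : freqResponse N₁⁻¹ ω * freqResponse N₁ ω = 1 := by
      have h2 := hmul _ N₁ _ (hE₁ ω hω) fun a b => stable _ (hs₁ a b) _ (hcirc ω).ge
      rw [Matrix.nonsing_inv_mul _ hm₁.1] at h2
      rw [freqResponse, freqResponse, ← h2.eval_eq]
      exact EntriesIn.one.eval_eq
    have h3 : freqResponse U ω = freqResponse N₁⁻¹ ω * freqResponse N₀ ω := (hU ω hω).eval_eq
    calc freqResponse U ω * (freqResponse U ω)ᴴ
        = freqResponse N₁⁻¹ ω * (freqResponse N₀ ω * (freqResponse N₀ ω)ᴴ) *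
            (freqResponse N₁⁻¹ ω)ᴴ := by
          rw [h3, Matrix.conjTranspose_mul]; simp only [Matrix.mul_assoc]
      _ = (freqResponse N₁⁻¹ ω * freqResponse N₁ ω) *
            (freqResponse N₁⁻¹ ω * freqResponse N₁ ω)ᴴ := by
          rw [hspec, Matrix.conjTranspose_mul]; simp only [Matrix.mul_assoc]
      _ = 1 := by rw [h1]; simp
  have hconj : ∀ ω ∉ E, freqResponse U' ω = (freqResponse U ω)ᴴ := by
    intro ω hω
    have h1 : freqResponse U' ω * freqResponse U ω = 1 := by
      have h2 := hmul U' U _ (fun a b => (hU' ω hω a b).1) (fun a b => (hU ω hω a b).1)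
      rw [hUU'] at h2
      rw [freqResponse, freqResponse, ← h2.eval_eq]
      exact EntriesIn.one.eval_eq
    calc freqResponse U' ω = freqResponse U' ω * (freqResponse U ω * (freqResponse U ω)ᴴ) := by
          rw [hunit ω hω, Matrix.mul_one]
      _ = (freqResponse U ω)ᴴ := by rw [← Matrix.mul_assoc, h1, Matrix.one_mul]
  have hconst : ∀ a b, U a b = RatFunc.C (valueAtInfinity (U a b)) := by
    intro a b
    refine eq_C_of_conj_on_circle (U a b) (U' b a) (fun z hz => hreg _ _ hm₁ hs₀ z hz a b)
      (fun z hz => hreg _ _ hm₀ hs₁ z hz b a) (hprop _ _ _ _ hD₁ hd₁ hD₀ a b)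
      (hprop _ _ _ _ hD₀ hd₀ hD₁ b a) E hE (fun ω hω => (hU ω hω a b).1)
      (fun ω hω => (hU' ω hω b a).1) (fun ω hω => ?_) (fun ω hω => ?_)
    · exact congrFun (congrFun (hconj ω hω) b) a
    · have h1 := congrFun (congrFun (hunit ω hω) a) a
      rw [Matrix.mul_apply, Matrix.one_apply_eq] at h1
      have h2 : ∑ c, ‖freqResponse U ω a c‖ ^ 2 = 1 := by
        have h3 : ((∑ c, ‖freqResponse U ω a c‖ ^ 2 : ℝ) : ℂ) = 1 := by
          rw [← h1]
          push_cast
          refine Finset.sum_congr rfl fun c _ => ?_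
          rw [Matrix.conjTranspose_apply]
          exact (Complex.mul_conj' _).symm
        exact_mod_cast h3
      have h4 : ‖freqResponse U ω a b‖ ^ 2 ≤ 1 := by
        rw [← h2]
        exact Finset.single_le_sum (f := fun c => ‖freqResponse U ω a c‖ ^ 2)
          (fun c _ => sq_nonneg _) (Finset.mem_univ b)
      exact (sq_le_one_iff₀ (norm_nonneg _)).mp h4
  refine ⟨Matrix.of fun a b => valueAtInfinity (U a b), ?_⟩
  have hU_eq : (Matrix.of fun a b => valueAtInfinity (U a b)).map RatFunc.C = U := by
    ext a b
    exact (hconst a b).symm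
  rw [hU_eq]
  exact (Matrix.mul_nonsing_inv_cancel_left _ _ hm₁.1).symm

end SpectralFactor

/-! ### Unit triangular matrices -/

section UnitTriangular

variable {ι α : Type*} [LinearOrder α] {F : Type*} [Field F]

/-- Triangular with ones on the diagonal, for the order of the indices given by `b`. -/
def IsUnitTriangular (b : ι → α) (A : Matrix ι ι F) : Prop :=
  A.BlockTriangular b ∧ ∀ i, A i i = 1

variable [Fintype ι] {b : ι → α} {A A' : Matrix ι ι F}

theorem Matrix.BlockTriangular.mul_apply_self (hb : Function.Injective b)
    (hA : A.BlockTriangular b) (hA' : A'.BlockTriangular b) (i : ι) :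
    (A * A') i i = A i i * A' i i := by
  rw [Matrix.mul_apply]
  refine Finset.sum_eq_single i (fun k _ hk => ?_) (by simp)
  rcases lt_trichotomy (b k) (b i) with h | h | h
  · rw [hA h, zero_mul]
  · exact absurd (hb h) hk
  · rw [hA' h, mul_zero]

theorem IsUnitTriangular.mul (hb : Function.Injective b) (hA : IsUnitTriangular b A)
    (hA' : IsUnitTriangular b A') : IsUnitTriangular b (A * A') :=
  ⟨hA.1.mul hA'.1, fun i => by rw [hA.1.mul_apply_self hb hA'.1, hA.2, hA'.2, one_mul]⟩

variable [DecidableEq ι]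

theorem IsUnitTriangular.det (hb : Function.Injective b) (hA : IsUnitTriangular b A) :
    A.det = 1 := by
  rw [hA.1.det]
  refine Finset.prod_eq_one fun a _ => ?_
  have : A.toSquareBlock b a = 1 := by
    ext ⟨i, hi⟩ ⟨j, hj⟩
    obtain rfl := hb (hi.trans hj.symm)
    rw [Matrix.one_apply_eq]
    exact hA.2 i
  rw [this, Matrix.det_one]

theorem IsUnitTriangular.inv (hb : Function.Injective b) (hA : IsUnitTriangular b A) :
    IsUnitTriangular b A⁻¹ := by
  have hdet : IsUnit A.det := by rw [hA.det hb]; exact isUnit_one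
  have : Invertible A := A.invertibleOfIsUnitDet hdet
  have htri := Matrix.blockTriangular_inv_of_blockTriangular hA.1
  refine ⟨htri, fun i => ?_⟩
  have h := congrFun (congrFun (Matrix.mul_nonsing_inv A hdet) i) i
  rwa [hA.1.mul_apply_self hb htri, hA.2, one_mul, Matrix.one_apply_eq] at h

/-- The unit triangular factor of a diagonal congruence between diagonal matrices is trivial. -/
theorem IsUnitTriangular.eq_one_of_congr_diag (hb : Function.Injective b)
    (hA : IsUnitTriangular b A) {Λ₀ Λ₁ : Matrix ι ι F} (h₀ : Λ₀.IsDiag) (h₁ : Λ₁.IsDiag)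
    (hdet : Λ₀.det ≠ 0) (h : A * Λ₀ * Aᵀ = Λ₁) : A = 1 := by
  have hunit : IsUnit A.det := by rw [hA.det hb]; exact isUnit_one
  have hinv := hA.inv hb
  -- The left side is triangular one way and the right side the other way, so both are diagonal.
  have h2 : A * Λ₀ = Λ₁ * (A⁻¹)ᵀ := by
    rw [← h, Matrix.mul_assoc, ← Matrix.transpose_mul, Matrix.nonsing_inv_mul _ hunit,
      Matrix.transpose_one, Matrix.mul_one]
  have hd₀ := h₀.diagonal_diag
  have hd₁ := h₁.diagonal_diag
  ext i j
  by_cases hij : i = j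
  · subst hij
    rw [hA.2, Matrix.one_apply_eq]
  rw [Matrix.one_apply_ne hij]
  rcases lt_trichotomy (b j) (b i) with hlt | heq | hgt
  · exact hA.1 hlt
  · exact absurd (hb heq).symm hij
  · have h3 := congrFun (congrFun h2 i) j
    rw [← hd₀, ← hd₁, Matrix.mul_diagonal, Matrix.diagonal_mul, Matrix.transpose_apply,
      hinv.1 hgt, mul_zero] at h3
    rcases mul_eq_zero.mp h3 with h4 | h4
    · exact h4
    · rw [← hd₀, Matrix.det_diagonal, Finset.prod_ne_zero_iff] at hdet
      exact absurd h4 (hdet j (Finset.mem_univ j))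

end UnitTriangular

/-! ### The spectral factor of a network is determined by the measured spectrum -/

namespace NetworkModelSet

variable {L K n : ℕ} (M : NetworkModelSet L K n)

/-- The feedthrough `G(∞)`. -/
def feedthrough (θ : Fin n → ℝ) : Matrix (Fin L) (Fin L) ℝ := (M.G θ).map valueAtInfinity

/-- The spectral factor `C T [H; 0]`. -/
def factor (θ : Fin n → ℝ) : Matrix M.C M.C (RatFunc ℝ) :=
  M.selC (RatFunc ℝ) * M.T θ * M.noise θ

/-- The value of the spectral factor at infinity. -/
def factorInfinity (θ : Fin n → ℝ) : Matrix M.C M.C ℝ :=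
  (1 - M.feedthrough θ)⁻¹.submatrix Subtype.val Subtype.val

variable {M} {θ : Fin n → ℝ}

/-- The principal minor of well-posedness on the full index set is the determinant of `I - G(∞)`, so
inversion is allowed already at infinity. -/
theorem T_placeInfinity (hθ : θ ∈ M.Θ) : (1 - M.G θ).det ≠ 0 ∧
    EntriesIn placeInfinity (M.T θ) (1 - M.feedthrough θ)⁻¹ := by
  have h : (1 - M.feedthrough θ).det ≠ 0 := by
    have h1 := M.wellPosed θ hθ Finset.univ
    have h2 := Matrix.det_submatrix_equiv_self
      (Equiv.subtypeUnivEquiv (fun x => Finset.mem_univ x) : {x // x ∈ Finset.univ} ≃ Fin L)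
      (1 - M.feedthrough θ)
    rw [← h2]
    exact h1
  exact (EntriesIn.one.sub (entriesIn_placeInfinity (M.G_proper θ hθ))).inv
    inv_mem_placeInfinity h

theorem T_mul_one_sub (hθ : θ ∈ M.Θ) : M.T θ * (1 - M.G θ) = 1 :=
  Matrix.nonsing_inv_mul _ (T_placeInfinity hθ).1.isUnit

theorem one_sub_mul_T (hθ : θ ∈ M.Θ) : (1 - M.G θ) * M.T θ = 1 :=
  Matrix.mul_nonsing_inv _ (T_placeInfinity hθ).1.isUnit

theorem noise_placeInfinity (hθ : θ ∈ M.Θ) : EntriesIn placeInfinity (M.noise θ)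
    ((1 : Matrix (Fin L) (Fin L) ℝ).submatrix id (Subtype.val : M.C → Fin L)) := by
  intro k a
  by_cases hk : k ∈ M.C
  · have h1 : M.noise θ k a = M.H θ ⟨k, hk⟩ a := dif_pos hk
    have h2 : ((1 : Matrix (Fin L) (Fin L) ℝ).submatrix id (Subtype.val : M.C → Fin L)) k a =
        (M.H θ).map valueAtInfinity ⟨k, hk⟩ a := by
      rw [M.H_monic θ hθ]
      simp [Matrix.one_apply, Subtype.ext_iff]
    rw [h1, h2]
    exact ⟨M.H_proper θ hθ _ _, rfl⟩
  · have h1 : M.noise θ k a = 0 := dif_neg hk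
    have h2 : ((1 : Matrix (Fin L) (Fin L) ℝ).submatrix id (Subtype.val : M.C → Fin L)) k a = 0 :=
      Matrix.one_apply_ne fun h : k = a => hk (h ▸ a.2)
    rw [h1, h2]
    exact placeInfinity.zero_mem

theorem factor_placeInfinity (hθ : θ ∈ M.Θ) :
    EntriesIn placeInfinity (M.factor θ) (M.factorInfinity θ) := by
  have h := ((EntriesIn.one.submatrix (Subtype.val : M.C → Fin L) id).mul
    (T_placeInfinity hθ).2).mul (noise_placeInfinity hθ)
  have e : M.factorInfinity θ = (1 : Matrix (Fin L) (Fin L) ℝ).submatrix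
      (Subtype.val : M.C → Fin L) id * (1 - M.feedthrough θ)⁻¹ *
      ((1 : Matrix (Fin L) (Fin L) ℝ).submatrix id (Subtype.val : M.C → Fin L)) := by
    ext a b
    simp [factorInfinity, Matrix.mul_apply, Matrix.one_apply]
  rw [e]
  exact h

theorem noise_eval₂_denom_ne_zero (hθ : θ ∈ M.Θ) {z : ℂ} (hz : 1 ≤ ‖z‖) (k : Fin L) (a : M.C) :
    (M.noise θ k a).denom.eval₂ (algebraMap ℝ ℂ) z ≠ 0 := by
  by_cases hk : k ∈ M.C
  · have h1 : M.noise θ k a = M.H θ ⟨k, hk⟩ a := dif_pos hk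
    rw [h1]
    exact fun h => absurd (M.H_stable θ hθ _ _ z h) (not_lt.mpr hz)
  · have h1 : M.noise θ k a = 0 := dif_neg hk
    rw [h1]
    simp

/-- The spectrum is defined by inverting the evaluated matrix `I - G`. Stability of `G` and `T`
allows `T (I - G) = I` to be evaluated at `z`, so this inverse is the value of `T`. -/
theorem factor_placeAt (hθ : θ ∈ M.Θ) {z : ℂ} (hz : 1 ≤ ‖z‖) :
    EntriesIn (placeAt z) (M.factor θ) (M.selC ℂ *
      (1 - (M.G θ).map (RatFunc.eval (algebraMap ℝ ℂ) z))⁻¹ *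
      (M.noise θ).map (RatFunc.eval (algebraMap ℝ ℂ) z)) := by
  have hG := entriesIn_placeAt (z := z) (A := M.G θ) fun a b h =>
    absurd (M.G_stable θ hθ a b z h) (not_lt.mpr hz)
  have hT := entriesIn_placeAt (z := z) (A := M.T θ) fun a b h =>
    absurd (M.T_stable θ hθ a b z h) (not_lt.mpr hz)
  have h1 := hT.mul (EntriesIn.one.sub hG)
  rw [T_mul_one_sub hθ] at h1
  have h2 : (M.T θ).map (RatFunc.eval (algebraMap ℝ ℂ) z) *
      (1 - (M.G θ).map (RatFunc.eval (algebraMap ℝ ℂ) z)) = 1 := by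
    rw [← h1.eval_eq]
    exact EntriesIn.one.eval_eq
  rw [Matrix.inv_eq_left_inv h2]
  exact ((EntriesIn.one.submatrix (Subtype.val : M.C → Fin L) id).mul hT).mul
    (entriesIn_placeAt (noise_eval₂_denom_ne_zero hθ hz))

theorem spectrumC_eq (hθ : θ ∈ M.Θ) (ω : ℝ) : M.spectrumC θ ω =
    freqResponse (M.factor θ) ω * (M.Λ θ).map (algebraMap ℝ ℂ) *
      (freqResponse (M.factor θ) ω)ᴴ := by
  have h := (factor_placeAt hθ (z := Complex.exp (ω * Complex.I))
    (Complex.norm_exp_ofReal_mul_I ω).ge).eval_eq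
  have hsel : (M.selC ℂ)ᴴ = (M.selC ℂ)ᵀ := by
    ext a b
    simp [selC, Matrix.conjTranspose_apply, Matrix.one_apply, apply_ite]
  rw [freqResponse, h, spectrumC, Φ, Matrix.conjTranspose_mul, Matrix.conjTranspose_mul, hsel]
  simp only [Matrix.mul_assoc]
  rfl

/-- One frequency with nonsingular spectrum suffices: every square factor in `spectrumC_eq` is
nonsingular there. -/
theorem FullRankSpectrum.exists_isUnit (hRank : M.FullRankSpectrum) (hθ : θ ∈ M.Θ) :
    (M.Λ θ).det ≠ 0 ∧ ∃ ω : ℝ, IsUnit (freqResponse (M.factor θ) ω) := by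
  obtain ⟨ω, hω⟩ := (hRank θ hθ).exists
  have h1 : IsUnit (M.spectrumC θ ω).det := by
    have h3 : LinearIndependent ℂ (M.spectrumC θ ω).col := by
      rw [linearIndependent_iff_card_eq_finrank_span, Set.finrank,
        ← Matrix.rank_eq_finrank_span_cols, hω]
      simp
    rwa [Matrix.linearIndependent_cols_iff_isUnit, Matrix.isUnit_iff_isUnit_det] at h3
  rw [spectrumC_eq hθ, Matrix.det_mul, Matrix.det_mul, isUnit_iff_ne_zero] at h1
  have h2 := left_ne_zero_of_mul h1
  refine ⟨fun h0 => right_ne_zero_of_mul h2 ?_, ω, ?_⟩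
  · have := RingHom.map_det (algebraMap ℝ ℂ) (M.Λ θ)
    rw [h0, map_zero] at this
    exact this.symm
  · rw [Matrix.isUnit_iff_isUnit_det]
    exact (left_ne_zero_of_mul h2).isUnit

-- Writing `Λ = B Bᵀ` with `B` real and nonsingular, the products of the factors with `B` have the
-- form required by `exists_eq_mul_C_of_spectrum_eq`. The constant found there is conjugated back to
-- `B₁ Q B₀⁻¹`.
open scoped MatrixOrder in
theorem exists_eq_mul_C_of_spectrumC_eq (hRank : M.FullRankSpectrum)
    (hMinPhase : M.MinimumPhaseFactor) (hD : ∀ θ ∈ M.Θ, (M.factorInfinity θ).det ≠ 0)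
    {θ₀ θ₁ : Fin n → ℝ} (h₀ : θ₀ ∈ M.Θ) (h₁ : θ₁ ∈ M.Θ)
    (hspec : ∀ ω : ℝ, M.spectrumC θ₀ ω = M.spectrumC θ₁ ω) :
    ∃ V : Matrix M.C M.C ℝ, M.factor θ₀ = M.factor θ₁ * V.map RatFunc.C := by
  have hB : ∀ θ ∈ M.Θ, ∃ B : Matrix M.C M.C ℝ, B.det ≠ 0 ∧ M.Λ θ = B * Bᵀ := by
    intro θ hθ
    obtain ⟨B, hB⟩ := CStarAlgebra.nonneg_iff_eq_star_mul_self.mp (M.Λ_posSemidef θ hθ).nonneg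
    rw [Matrix.star_eq_conjTranspose, Matrix.conjTranspose_eq_transpose_of_trivial] at hB
    refine ⟨Bᵀ, fun h0 => (hRank.exists_isUnit hθ).1 ?_, by rw [hB, Matrix.transpose_transpose]⟩
    rw [hB, Matrix.det_mul, h0, zero_mul]
  have hCinv : ∀ B : Matrix M.C M.C ℝ, B.det ≠ 0 → B.map RatFunc.C * B⁻¹.map RatFunc.C = 1 := by
    intro B hB
    rw [← Matrix.map_mul, Matrix.mul_nonsing_inv _ hB.isUnit,
      Matrix.map_one _ (map_zero _) (map_one _)]
  let N : (Fin n → ℝ) → Matrix M.C M.C ℝ → Matrix M.C M.C (RatFunc ℝ) := fun θ B =>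
    M.factor θ * B.map RatFunc.C
  have hNat : ∀ θ ∈ M.Θ, ∀ B : Matrix M.C M.C ℝ, ∀ z : ℂ, 1 ≤ ‖z‖ → EntriesIn (placeAt z) (N θ B)
      ((M.factor θ).map (RatFunc.eval (algebraMap ℝ ℂ) z) * B.map (algebraMap ℝ ℂ)) :=
    fun θ hθ B z hz => (entriesIn_placeAt fun a b => (factor_placeAt hθ hz a b).1).mul
      (entriesIn_C_placeAt B z)
  have hNs : ∀ θ ∈ M.Θ, ∀ B a b, IsStableTF (N θ B a b) := by
    intro θ hθ B a b z hz
    by_contra h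
    exact (hNat θ hθ B z (not_lt.mp h) a b).1 hz
  have hNm : ∀ θ ∈ M.Θ, ∀ B : Matrix M.C M.C ℝ, B.det ≠ 0 → IsMinimumPhase (N θ B) := by
    intro θ hθ B hB
    have hinv : N θ B * (B⁻¹.map RatFunc.C * (M.factor θ)⁻¹) = 1 := by
      simp only [N]
      rw [Matrix.mul_assoc, ← Matrix.mul_assoc (B.map _), hCinv B hB, Matrix.one_mul]
      exact Matrix.mul_nonsing_inv _ (hMinPhase θ hθ).1
    refine ⟨Matrix.isUnit_det_of_right_inverse hinv, fun a b z hz => ?_⟩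
    rw [Matrix.inv_eq_right_inv hinv] at hz
    by_contra hlt
    have hW := entriesIn_placeAt (z := z) (A := (M.factor θ)⁻¹) fun a b h =>
      hlt ((hMinPhase θ hθ).2 a b z h)
    exact ((entriesIn_C_placeAt B⁻¹ z).mul hW a b).1 hz
  have hNinf : ∀ θ ∈ M.Θ, ∀ B : Matrix M.C M.C ℝ,
      EntriesIn placeInfinity (N θ B) (M.factorInfinity θ * B) := fun θ hθ B =>
    (factor_placeInfinity hθ).mul (entriesIn_C_placeInfinity B)
  have hNspec : ∀ θ ∈ M.Θ, ∀ B : Matrix M.C M.C ℝ, M.Λ θ = B * Bᵀ → ∀ ω,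
      freqResponse (N θ B) ω * (freqResponse (N θ B) ω)ᴴ = M.spectrumC θ ω := by
    intro θ hθ B hB ω
    have h1 : freqResponse (N θ B) ω = freqResponse (M.factor θ) ω * B.map (algebraMap ℝ ℂ) :=
      (hNat θ hθ B _ (Complex.norm_exp_ofReal_mul_I ω).ge).eval_eq
    have h2 : (B.map (algebraMap ℝ ℂ))ᴴ = Bᵀ.map (algebraMap ℝ ℂ) := by
      ext a b
      simp
    rw [spectrumC_eq hθ, h1, hB, Matrix.conjTranspose_mul, h2, Matrix.map_mul]
    simp only [Matrix.mul_assoc]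
  obtain ⟨B₀, hB₀, hΛ₀⟩ := hB θ₀ h₀
  obtain ⟨B₁, hB₁, hΛ₁⟩ := hB θ₁ h₁
  obtain ⟨Q, hQ⟩ := exists_eq_mul_C_of_spectrum_eq (N θ₀ B₀) (N θ₁ B₁) (hNs θ₀ h₀ B₀)
    (hNs θ₁ h₁ B₁) (hNm θ₀ h₀ B₀ hB₀) (hNm θ₁ h₁ B₁ hB₁) _ _ (hNinf θ₀ h₀ B₀) (hNinf θ₁ h₁ B₁)
    (by rw [Matrix.det_mul]; exact mul_ne_zero (hD θ₀ h₀) hB₀)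
    (by rw [Matrix.det_mul]; exact mul_ne_zero (hD θ₁ h₁) hB₁)
    (fun ω => by rw [hNspec θ₀ h₀ B₀ hΛ₀, hNspec θ₁ h₁ B₁ hΛ₁, hspec])
  refine ⟨B₁ * Q * B₀⁻¹, ?_⟩
  calc M.factor θ₀ = N θ₀ B₀ * B₀⁻¹.map RatFunc.C := by
        simp only [N]
        rw [Matrix.mul_assoc, hCinv B₀ hB₀, Matrix.mul_one]
    _ = M.factor θ₁ * (B₁ * Q * B₀⁻¹).map RatFunc.C := by
        rw [hQ, Matrix.map_mul, Matrix.map_mul]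
        simp only [N, Matrix.mul_assoc]

theorem FeedthroughCondition.isUnitTriangular (h : M.FeedthroughCondition) :
    (∀ θ ∈ M.Θ, M.factorInfinity θ = 1) ∨
    ((∀ θ ∈ M.Θ, (M.Λ θ).IsDiag) ∧ ∃ b : M.C → (Fin L)ᵒᵈ, Function.Injective b ∧
      ∀ θ ∈ M.Θ, IsUnitTriangular b (M.factorInfinity θ)) := by
  rcases h with h | ⟨hΛ, σ, hσ⟩
  · refine Or.inl fun θ hθ => ?_
    have h0 : M.feedthrough θ = 0 := by
      ext a b
      refine Polynomial.coeff_eq_zero_of_degree_lt ?_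
      rw [← Polynomial.degree_eq_natDegree (RatFunc.denom_ne_zero _)]
      exact h θ hθ a b
    rw [factorInfinity, h0, sub_zero, inv_one]
    exact Matrix.submatrix_one _ Subtype.val_injective
  -- `Matrix.BlockTriangular` means upper triangular, so the lower triangular feedthrough calls for
  -- the dual order.
  · refine Or.inr ⟨hΛ, fun a => OrderDual.toDual (σ.symm a), ?_, fun θ hθ => ?_⟩
    · exact OrderDual.toDual.injective.comp (σ.symm.injective.comp Subtype.val_injective)
    · have h1 : IsUnitTriangular (fun a => OrderDual.toDual (σ.symm a))
          (1 - M.feedthrough θ) := by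
        refine ⟨fun a b hab => ?_, fun a => ?_⟩
        · have hab' : σ.symm a < σ.symm b := hab
          have hne : a ≠ b := fun h => hab'.ne (by rw [h])
          have := hσ θ hθ _ _ hab'
          rw [Equiv.apply_symm_apply, Equiv.apply_symm_apply] at this
          rw [Matrix.sub_apply, Matrix.one_apply_ne hne, zero_sub, neg_eq_zero]
          exact this
        · have h2 : M.feedthrough θ a a = 0 := by
            have h3 := valueAtInfinity_C 0
            rw [map_zero] at h3
            change valueAtInfinity (M.G θ a a) = 0
            rw [M.G_hollow θ hθ, h3]
          rw [Matrix.sub_apply, h2, Matrix.one_apply_eq, sub_zero]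
      have h2 := h1.inv (OrderDual.toDual.injective.comp σ.symm.injective)
      exact ⟨h2.1.submatrix, fun a => h2.2 a⟩

/-- Equal measured spectra have equal spectral factors. -/
theorem factor_eq_of_spectrumC_eq (hRank : M.FullRankSpectrum) (hFeed : M.FeedthroughCondition)
    (hMinPhase : M.MinimumPhaseFactor) {θ₀ θ₁ : Fin n → ℝ} (h₀ : θ₀ ∈ M.Θ) (h₁ : θ₁ ∈ M.Θ)
    (hspec : ∀ ω : ℝ, M.spectrumC θ₀ ω = M.spectrumC θ₁ ω) : M.factor θ₀ = M.factor θ₁ := by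
  have hfeed := hFeed.isUnitTriangular
  have hD : ∀ θ ∈ M.Θ, (M.factorInfinity θ).det ≠ 0 := by
    intro θ hθ
    rcases hfeed with h | ⟨-, b, hb, h⟩
    · rw [h θ hθ, Matrix.det_one]; exact one_ne_zero
    · rw [(h θ hθ).det hb]; exact one_ne_zero
  obtain ⟨V, hV⟩ := exists_eq_mul_C_of_spectrumC_eq hRank hMinPhase hD h₀ h₁ hspec
  -- The constant `V` is read off at infinity: it is the identity in the strictly proper case and
  -- unit triangular otherwise.
  have hDV : M.factorInfinity θ₀ = M.factorInfinity θ₁ * V := by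
    have h2 := factor_placeInfinity h₀
    have h3 := (factor_placeInfinity h₁).mul (entriesIn_C_placeInfinity V)
    rw [← hV] at h3
    ext a b
    exact (h2 a b).2.symm.trans (h3 a b).2
  have hV' : V = (M.factorInfinity θ₁)⁻¹ * M.factorInfinity θ₀ := by
    rw [hDV, Matrix.nonsing_inv_mul_cancel_left _ _ (hD θ₁ h₁).isUnit]
  suffices h : V = 1 by
    rw [hV, h, Matrix.map_one _ (map_zero _) (map_one _), Matrix.mul_one]
  rcases hfeed with h | ⟨hdiag, b, hb, h⟩
  · rw [hV', h θ₀ h₀, h θ₁ h₁, inv_one, Matrix.one_mul]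
  · have htri : IsUnitTriangular b V := by
      rw [hV']
      exact ((h θ₁ h₁).inv hb).mul hb (h θ₀ h₀)
    refine htri.eq_one_of_congr_diag hb (hdiag θ₀ h₀) (hdiag θ₁ h₁)
      (hRank.exists_isUnit h₀).1 ?_
    -- At a frequency where the factor is invertible it cancels from the spectra, leaving `V Λ₀ Vᵀ =
    -- Λ₁` between diagonal matrices.
    obtain ⟨ω, hω⟩ := (hRank.exists_isUnit h₁).2
    have hs := hspec ω
    rw [spectrumC_eq h₀, spectrumC_eq h₁] at hs
    have hW : freqResponse (M.factor θ₀) ω =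
        freqResponse (M.factor θ₁) ω * V.map (algebraMap ℝ ℂ) := by
      rw [hV]
      exact ((entriesIn_placeAt fun a b => (factor_placeAt h₁
        (Complex.norm_exp_ofReal_mul_I ω).ge a b).1).mul (entriesIn_C_placeAt V _)).eval_eq
    have hVt : (V.map (algebraMap ℝ ℂ))ᴴ = Vᵀ.map (algebraMap ℝ ℂ) := by
      ext a b
      simp
    have hs' : freqResponse (M.factor θ₁) ω * (V * M.Λ θ₀ * Vᵀ).map (algebraMap ℝ ℂ) *
        (freqResponse (M.factor θ₁) ω)ᴴ = freqResponse (M.factor θ₁) ω *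
        (M.Λ θ₁).map (algebraMap ℝ ℂ) * (freqResponse (M.factor θ₁) ω)ᴴ := by
      rw [← hs, hW, Matrix.conjTranspose_mul, hVt, Matrix.map_mul, Matrix.map_mul]
      simp only [Matrix.mul_assoc]
    have hωH : IsUnit (freqResponse (M.factor θ₁) ω)ᴴ := by
      rw [← Matrix.star_eq_conjTranspose]
      exact hω.star
    have h4 := hω.mul_left_cancel (hωH.mul_right_cancel hs')
    exact Matrix.map_injective (algebraMap ℝ ℂ).injective h4

end NetworkModelSet

/-! ### Disjoint paths bound the rank for every parameter -/

/-- Linearly independent rows have a nonsingular square selection of columns. -/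
theorem exists_det_ne_zero_of_linearIndependent {F κ : Type*} [Field F] [Finite κ] {k : ℕ}
    (f : Fin k → κ → F) (hf : LinearIndependent F f) :
    ∃ c : Fin k → κ, (Matrix.of fun i j => f i (c j)).det ≠ 0 := by
  classical
  have : Fintype κ := Fintype.ofFinite κ
  let A : Matrix (Fin k) κ F := Matrix.of f
  have hrank : Module.finrank F (Submodule.span F (Set.range A.col)) = k := by
    rw [← Matrix.rank_eq_finrank_span_cols]
    have : LinearIndependent F A.row := hf
    simpa using this.rank_matrix
  obtain ⟨g, hg, -, hli⟩ := Submodule.exists_fun_fin_finrank_span_eq F (Set.range A.col)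
  choose c hc using hg
  let e : Fin k ≃ Fin (Module.finrank F (Submodule.span F (Set.range A.col))) :=
    finCongr hrank.symm
  refine ⟨fun j => c (e j), ?_⟩
  have h2 : LinearIndependent F (A.submatrix id fun j => c (e j)).col := by
    have h3 : (A.submatrix id fun j => c (e j)).col = g ∘ e := by
      ext j i
      exact congrFun (hc (e j)) i
    rw [h3]
    exact hli.comp e e.injective
  rw [Matrix.linearIndependent_cols_iff_isUnit, Matrix.isUnit_iff_isUnit_det] at h2
  exact h2.ne_zero

namespace NetworkModelSet

variable {L K n : ℕ} (M : NetworkModelSet L K n)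

/-- The way in which a signal enters the network equations: a unit vector for an internal signal, a
column of `X` for an external signal. -/
def source (θ : Fin n → ℝ) (v : M.Vertex) : Fin L → RatFunc ℝ :=
  Sum.elim (fun k => Pi.single k 1) (fun e u => M.X θ u e) v

/-- The response of the internal signals to a signal: the columns of `[T  T X]`. -/
def response (θ : Fin n → ℝ) (v : M.Vertex) : Fin L → RatFunc ℝ := M.T θ *ᵥ M.source θ v

/-- The response of the internal signals in a set. -/
def responseOn (θ : Fin n → ℝ) (Cbar : Set (Fin L)) (v : M.Vertex) : Cbar → RatFunc ℝ :=
  fun c => M.response θ v c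

variable {M} {θ : Fin n → ℝ}

/-- Disjoint paths start at different vertices. Without a bound, `sSup` on the natural numbers would
default to `0`. -/
theorem bddAbove_disjoint_paths (S₁ S₂ : Set M.Vertex) :
    BddAbove {k | ∃ p : Fin k → List M.Vertex, (∀ a, M.IsPath S₁ S₂ (p a)) ∧
      ∀ a b, a ≠ b → (p a).Disjoint (p b)} := by
  refine ⟨Fintype.card M.Vertex, ?_⟩
  rintro k ⟨p, hp, hdisj⟩
  choose h hh _ using fun a => (hp a).2.2.1
  have hinj : Function.Injective h := by
    intro a b hab
    by_contra hne
    exact hdisj a b hne (List.mem_of_head? (hh a)) (hab ▸ List.mem_of_head? (hh b))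
  simpa using Fintype.card_le_of_injective h hinj

theorem exists_perm_of_det_ne_zero {F m : Type*} [Field F] [Fintype m] [DecidableEq m]
    (B : Matrix m m F) (hB : B.det ≠ 0) : ∃ σ : Equiv.Perm m, ∀ x, B x (σ x) ≠ 0 := by
  rw [Matrix.det_apply] at hB
  obtain ⟨σ, -, hσ⟩ := Finset.exists_ne_zero_of_sum_ne_zero hB
  have h : ∏ x, B (σ x) x ≠ 0 := fun h => hσ (by rw [h, smul_zero])
  rw [Finset.prod_ne_zero_iff] at h
  refine ⟨σ.symm, fun x => ?_⟩
  simpa using h (σ.symm x) (Finset.mem_univ _)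

/-- The rank of the transfer from `S` to `Cbar` is at most the number of disjoint paths. -/
theorem finrank_span_responseOn_le (hθ : θ ∈ M.Θ) (S : Set M.Vertex) (Cbar : Set (Fin L)) :
    Module.finrank (RatFunc ℝ) (Submodule.span (RatFunc ℝ) (M.responseOn θ Cbar '' S)) ≤
      M.maxDisjointPaths S (Sum.inl '' Cbar) := by
  classical
  obtain ⟨f, hf, -, hli⟩ :=
    Submodule.exists_fun_fin_finrank_span_eq (RatFunc ℝ) (M.responseOn θ Cbar '' S)
  generalize Module.finrank (RatFunc ℝ) (Submodule.span (RatFunc ℝ) (M.responseOn θ Cbar '' S)) = k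
    at f hf hli ⊢
  choose v hvS hv using hf
  obtain ⟨c, hc⟩ := exists_det_ne_zero_of_linearIndependent f hli
  refine le_csSup (bddAbove_disjoint_paths _ _) ?_
  -- Bordering `A` by the sources `v` and targets `c` gives, by the Schur complement, a determinant
  -- equal up to sign to `det A` times the chosen minor of the response. A nonzero term of its
  -- Leibniz expansion is a permutation that moves against edges.
  let A : Matrix M.Vertex M.Vertex (RatFunc ℝ) := Matrix.fromBlocks (1 - M.G θ) (-M.X θ) 0 1
  let A' : Matrix M.Vertex M.Vertex (RatFunc ℝ) :=
    Matrix.fromBlocks (M.T θ) (M.T θ * M.X θ) 0 1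
  let B₁ : Matrix M.Vertex (Fin k) (RatFunc ℝ) := Matrix.of fun u b => if u = v b then 1 else 0
  let B₂ : Matrix (Fin k) M.Vertex (RatFunc ℝ) :=
    Matrix.of fun a w => if w = Sum.inl (c a : Fin L) then 1 else 0
  have hAA' : A' * A = 1 := by
    simp only [A, A', Matrix.fromBlocks_multiply, Matrix.mul_zero, Matrix.zero_mul, Matrix.mul_one,
      add_zero, zero_add, neg_zero, T_mul_one_sub hθ, Matrix.mul_neg, neg_add_cancel,
      Matrix.fromBlocks_one]
  have hA'A : A * A' = 1 := mul_eq_one_comm.mp hAA'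
  let inst : Invertible A := ⟨A', hAA', hA'A⟩
  have hresp : ∀ l w, A' (Sum.inl l) w = M.response θ w l := by
    intro l w
    rcases w with k' | e
    · simp [A', response, source]
    · simp [A', response, source, Matrix.mul_apply, Matrix.mulVec, dotProduct]
  have hdet : (Matrix.fromBlocks A B₁ B₂ 0).det ≠ 0 := by
    rw [Matrix.det_fromBlocks₁₁]
    refine mul_ne_zero (Matrix.isUnit_det_of_left_inverse hAA').ne_zero ?_
    have h1 : B₂ * ⅟A * B₁ = (Matrix.of fun i j => f i (c j))ᵀ := by
      ext a b
      have : ⅟A = A' := rfl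
      rw [this]
      simp only [Matrix.mul_apply, B₂, B₁, Matrix.of_apply, ite_mul, one_mul, zero_mul,
        mul_ite, mul_one, mul_zero, Finset.sum_ite_eq', Finset.mem_univ, if_true,
        Matrix.transpose_apply, hresp]
      rw [← hv]
      rfl
    rw [h1, zero_sub, Matrix.det_neg, Matrix.det_transpose]
    exact mul_ne_zero (pow_ne_zero _ (neg_ne_zero.mpr one_ne_zero)) hc
  obtain ⟨σ, hσ⟩ := exists_perm_of_det_ne_zero _ hdet
  obtain ⟨p, hp, hdisj⟩ := exists_disjoint_paths_of_perm M.Edge σ v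
    (fun a => Sum.inl (c a : Fin L)) (fun u w huw hne => by
      have h := hσ (Sum.inl u)
      rw [huw, Matrix.fromBlocks_apply₁₁] at h
      rcases u with u | e
      · refine ⟨θ, hθ, ?_⟩
        rcases w with w | e
        · have hne' : u ≠ w := fun h => hne (by rw [h])
          simpa [A, entry, Matrix.one_apply, hne'] using h
        · simpa [A, entry] using h
      · rcases w with w | e'
        · simp [A] at h
        · have hne' : e ≠ e' := fun h => hne (by rw [h])
          exact absurd (by simp [A, hne']) h)
    (fun u b hub => by
      have h := hσ (Sum.inl u)
      rw [hub, Matrix.fromBlocks_apply₁₂] at h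
      simpa [B₁] using h)
    (fun a => by
      have h := hσ (Sum.inr a)
      rcases hx : σ (Sum.inr a) with w | b
      · rw [hx, Matrix.fromBlocks_apply₂₁] at h
        have hw : w = Sum.inl (c a : Fin L) := by simpa [B₂] using h
        rw [hw]
      · rw [hx, Matrix.fromBlocks_apply₂₂] at h
        simp at h)
  refine ⟨p, fun a => ⟨(hp a).1, (hp a).2.1, ?_, ?_⟩, hdisj⟩
  · obtain ⟨b, hb⟩ := (hp a).2.2.1
    exact ⟨v b, hb, hvS b⟩
  · exact ⟨_, (hp a).2.2.2, c a, (c a).2, rfl⟩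

end NetworkModelSet

/-! ### Disjoint paths give the generic rank -/

section IsRationalIn

variable {n : ℕ} {Θ : Set (Fin n → ℝ)} {S : Set (Fin n)}

theorem isRationalIn_of_eq_C {f : (Fin n → ℝ) → RatFunc ℝ} (a : ℝ)
    (hf : ∀ θ ∈ Θ, f θ = RatFunc.C a) : IsRationalIn Θ S f := by
  have hvars : ∀ (b : ℝ) k, (((Polynomial.C (MvPolynomial.C b) :
      Polynomial (MvPolynomial (Fin n) ℝ)).coeff k).vars : Set (Fin n)) ⊆ S := by
    intro b k
    rw [Polynomial.coeff_C]
    split_ifs <;> simp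
  refine ⟨Polynomial.C (MvPolynomial.C a), Polynomial.C (MvPolynomial.C 1), hvars a, hvars 1,
    fun θ hθ => ⟨by simp, ?_⟩⟩
  rw [hf θ hθ]
  simp

theorem IsRationalIn.sub_one {f g : (Fin n → ℝ) → RatFunc ℝ} (hf : IsRationalIn Θ S f)
    (hg : ∀ θ ∈ Θ, g θ = f θ - 1) : IsRationalIn Θ S g := by
  classical
  obtain ⟨p, d, hp, hd, h⟩ := hf
  refine ⟨p - d, d, fun k => ?_, hd, fun θ hθ => ⟨(h θ hθ).1, ?_⟩⟩
  · rw [Polynomial.coeff_sub]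
    refine (Finset.coe_subset.mpr fun _ h => MvPolynomial.vars_sub_subset _ h).trans ?_
    rw [Finset.coe_union]
    exact Set.union_subset (hp k) (hd k)
  · rw [hg θ hθ, (h θ hθ).2, Polynomial.map_sub, map_sub, sub_div,
      div_self (RatFunc.algebraMap_ne_zero (h θ hθ).1)]

theorem IsRationalIn.congr {f g : (Fin n → ℝ) → RatFunc ℝ} (hf : IsRationalIn Θ S f)
    (hg : ∀ θ ∈ Θ, g θ = f θ) : IsRationalIn Θ S g := by
  obtain ⟨p, d, hp, hd, h⟩ := hf
  exact ⟨p, d, hp, hd, fun θ hθ => ⟨(h θ hθ).1, (hg θ hθ).trans (h θ hθ).2⟩⟩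

end IsRationalIn

namespace NetworkModelSet

variable {L K n : ℕ} {M : NetworkModelSet L K n}

/-- Subtracting the identity adds no parameters, and the columns of `R` and the zero rows of the
noise model need none, so these entries receive the empty set. -/
theorem IndependentlyParameterized.incidence (hIndep : M.IndependentlyParameterized) :
    ∃ S : Fin L → M.Vertex → Set (Fin n),
      (∀ a b a' b', (a, b) ≠ (a', b') → Disjoint (S a b) (S a' b')) ∧
      ∀ a b, IsRationalIn M.Θ (S a b) (fun θ => M.incidence θ a b) := by
  obtain ⟨SG, SH, hG, hH, hGG, hHH, hGH⟩ := hIndep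
  let S : Fin L → M.Vertex → Set (Fin n) := fun j v => match v with
    | Sum.inl i => SG j i
    | Sum.inr (Sum.inl _) => ∅
    | Sum.inr (Sum.inr a) => if hj : j ∈ M.C then SH ⟨j, hj⟩ a else ∅
  refine ⟨S, ?_, ?_⟩
  · rintro j (i | p | a) j' (i' | p' | a') hne
    · exact hGG _ _ _ _ fun h => hne (by simp_all)
    · exact Set.disjoint_empty _
    · by_cases hj : j' ∈ M.C
      · simpa [S, hj] using hGH j i ⟨j', hj⟩ a'
      · simp [S, hj]
    · exact Set.empty_disjoint _
    · exact Set.empty_disjoint _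
    · exact Set.empty_disjoint _
    · by_cases hj : j ∈ M.C
      · simpa [S, hj] using (hGH j' i' ⟨j, hj⟩ a).symm
      · simp [S, hj]
    · exact Set.disjoint_empty _
    · by_cases hj : j ∈ M.C <;> by_cases hj' : j' ∈ M.C
      · simp only [S, hj, hj', dite_true]
        exact hHH _ _ _ _ fun h => hne (by simp_all)
      all_goals simp [S, hj, hj']
  · rintro j (i | p | a)
    · by_cases hji : j = i
      · subst hji
        exact (hG j j).sub_one fun θ _ => by simp [NetworkModelSet.incidence]
      · exact (hG j i).congr fun θ _ => by
          simp [NetworkModelSet.incidence, Matrix.one_apply_ne hji]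
    · by_cases hjp : j = M.exc p
      · exact isRationalIn_of_eq_C 1 fun θ _ => by
          subst hjp
          exact (Matrix.one_apply_eq (M.exc p)).trans (map_one RatFunc.C).symm
      · exact isRationalIn_of_eq_C 0 fun θ _ => by
          exact (Matrix.one_apply_ne hjp).trans (map_zero RatFunc.C).symm
    · by_cases hj : j ∈ M.C
      · simp only [S, hj, dite_true]
        exact (hH ⟨j, hj⟩ a).congr fun θ _ => by
          simp [NetworkModelSet.incidence, X, noise, hj]
      · exact isRationalIn_of_eq_C 0 fun θ _ => by
          simp [NetworkModelSet.incidence, X, noise, hj]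

/-- Disjoint paths that are matched to a nonsingular submatrix of `[G - I  X]` have linearly
independent responses. -/
theorem linearIndependent_responseOn {θ : Fin n → ℝ} (hθ : θ ∈ M.Θ) {Cbar : Set (Fin L)} {k : ℕ}
    (h : Fin k → M.Vertex) (hinj : Function.Injective h) (c : M.Vertex → M.Vertex)
    (hc : Set.InjOn c {u | ∀ a, h a ≠ u})
    (hcover : ∀ w, w ∉ (Sum.inl '' Cbar : Set M.Vertex) →
      ∃ u, (∀ a, h a ≠ u) ∧ c u = w ∧ (u = w ∨ M.Edge w u))
    (hdet : ((M.incidence θ).submatrix (Subtype.val : {u : Fin L // ∀ a, h a ≠ Sum.inl u} → Fin L)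
      (fun u => c (Sum.inl u.1))).det ≠ 0) :
    LinearIndependent (RatFunc ℝ) fun a => M.responseOn θ Cbar (h a) := by
  classical
  rw [Fintype.linearIndependent_iff]
  intro y hy
  -- A relation `y` among the responses becomes a signal vector `x` that satisfies the network
  -- equations in every row that is not the head of a path.
  let xL : Fin L → RatFunc ℝ := ∑ a, y a • M.response θ (h a)
  let xE : M.Ext → RatFunc ℝ := fun e => ∑ a, if h a = Sum.inr e then y a else 0
  let x : M.Vertex → RatFunc ℝ := Sum.elim xL xE
  have hxL : (1 - M.G θ) *ᵥ xL = ∑ a, y a • M.source θ (h a) := by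
    simp only [xL, response, Matrix.mulVec_sum, Matrix.mulVec_smul, Matrix.mulVec_mulVec,
      one_sub_mul_T hθ, Matrix.one_mulVec]
  have hxC : ∀ l ∈ Cbar, xL l = 0 := by
    intro l hl
    have := congrFun hy ⟨l, hl⟩
    simpa [xL, responseOn, Finset.sum_apply] using this
  have hxE : M.X θ *ᵥ xE = ∑ a, y a • (Sum.elim (fun _ _ => 0) (fun e u => M.X θ u e) (h a) : Fin L → RatFunc ℝ) := by
    ext u
    simp only [Matrix.mulVec, dotProduct, xE, Finset.mul_sum, Finset.sum_apply, Pi.smul_apply,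
      smul_eq_mul]
    rw [Finset.sum_comm]
    refine Finset.sum_congr rfl fun a _ => ?_
    rcases ha : h a with l | e
    · simp
    · simp [mul_comm]
  have hrow : ∀ u : Fin L, (∀ a, h a ≠ Sum.inl u) → (M.incidence θ *ᵥ x) u = 0 := by
    intro u hu
    have h1 : M.incidence θ *ᵥ x = M.X θ *ᵥ xE - (1 - M.G θ) *ᵥ xL := by
      rw [incidence, Matrix.fromCols_mulVec, ← neg_sub (1 : Matrix (Fin L) (Fin L) (RatFunc ℝ)),
        Matrix.neg_mulVec, neg_add_eq_sub]
      rfl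
    rw [h1, hxL, hxE, ← Finset.sum_sub_distrib, Finset.sum_apply]
    refine Finset.sum_eq_zero fun a _ => ?_
    rcases ha : h a with l | e
    · have hul : u ≠ l := fun hul => hu a (by rw [ha, hul])
      simp [source, hul]
    · simp [source]
  -- An unmatched column belongs either to `Cbar`, where the relation makes `x` vanish, or to an
  -- external signal that heads no path. Only the matched columns remain, and there the matrix is
  -- nonsingular.
  have hx0 : ∀ w, w ∉ Set.range (fun u : {u : Fin L // ∀ a, h a ≠ Sum.inl u} => c (Sum.inl u.1)) →
      x w = 0 := by
    intro w hw
    by_cases hwC : w ∈ (Sum.inl '' Cbar : Set M.Vertex)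
    · obtain ⟨l, hl, rfl⟩ := hwC
      exact hxC l hl
    · obtain ⟨u, hu, hcu, huw⟩ := hcover w hwC
      rcases u with u | e
      · exact absurd ⟨⟨u, hu⟩, hcu⟩ hw
      · rcases huw with rfl | huw
        · exact Finset.sum_eq_zero fun a _ => if_neg (hu a)
        · exact huw.elim
  have hcinj : Function.Injective
      (fun u : {u : Fin L // ∀ a, h a ≠ Sum.inl u} => c (Sum.inl u.1)) := fun u u' huu' =>
    Subtype.ext (Sum.inl_injective (hc u.2 u'.2 huu'))
  have hzero := Matrix.eq_zero_of_mulVec_eq_zero hdet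
    (v := fun u : {u : Fin L // ∀ a, h a ≠ Sum.inl u} => x (c (Sum.inl u.1))) (by
      ext u
      refine Eq.trans ?_ (hrow u.1 u.2)
      refine Fintype.sum_of_injective _ hcinj _ _ (fun w hw => ?_) fun _ => rfl
      rw [hx0 w hw, mul_zero])
  have hx : ∀ w, x w = 0 := by
    intro w
    by_cases hw : w ∈ Set.range (fun u : {u : Fin L // ∀ a, h a ≠ Sum.inl u} => c (Sum.inl u.1))
    · obtain ⟨u, rfl⟩ := hw
      exact congrFun hzero u
    · exact hx0 w hw
  have hyE : ∀ a e, h a = Sum.inr e → y a = 0 := by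
    intro a e ha
    have h1 : xE e = 0 := hx (Sum.inr e)
    rw [← h1]
    simp only [xE]
    rw [Finset.sum_eq_single a, if_pos ha]
    · exact fun b _ hb => if_neg fun hbe => hb (hinj (hbe.trans ha.symm))
    · exact fun ha => absurd (Finset.mem_univ a) ha
  intro a
  rcases ha : h a with l | e
  · have hxL0 : xL = 0 := funext fun l => hx (Sum.inl l)
    rw [hxL0, Matrix.mulVec_zero] at hxL
    have h1 := congrFun hxL l
    rw [Finset.sum_apply, Finset.sum_eq_single a] at h1
    · simpa [ha, source] using h1.symm
    · intro b _ hb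
      rcases hbv : h b with l' | e
      · have hll' : l ≠ l' := fun hl => hb (hinj (by rw [hbv, ha, hl]))
        simp [source, hll']
      · simp [hyE b e hbv]
    · exact fun ha => absurd (Finset.mem_univ a) ha
  · exact hyE a e ha

/-- Generically, the rank of the transfer from `S` to `Cbar` is at least the number of disjoint
paths. -/
theorem ae_maxDisjointPaths_le_finrank (hΘ : M.Θ.Nonempty) (hIndep : M.IndependentlyParameterized)
    (hFixed : M.FixedEntriesRegular) (S : Set M.Vertex) (Cbar : Set (Fin L)) :
    ∀ᵐ θ ∂(volume : Measure (Fin n → ℝ)), θ ∈ M.Θ → M.maxDisjointPaths S (Sum.inl '' Cbar) ≤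
      Module.finrank (RatFunc ℝ) (Submodule.span (RatFunc ℝ) (M.responseOn θ Cbar '' S)) := by
  classical
  obtain ⟨p, hp, hdisj⟩ : M.maxDisjointPaths S (Sum.inl '' Cbar) ∈
      {k | ∃ p : Fin k → List M.Vertex, (∀ a, M.IsPath S (Sum.inl '' Cbar) (p a)) ∧
        ∀ a b, a ≠ b → (p a).Disjoint (p b)} :=
    Nat.sSup_mem ⟨0, Fin.elim0, fun a => a.elim0, fun a => a.elim0⟩ (bddAbove_disjoint_paths _ _)
  generalize M.maxDisjointPaths S (Sum.inl '' Cbar) = k at p hp hdisj ⊢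
  choose h hh hhS using fun a => (hp a).2.2.1
  have hh' : ∀ a, (p a).head? = some (h a) := hh
  have hinj : Function.Injective h := by
    intro a b hab
    by_contra hne
    exact hdisj a b hne (List.mem_of_head? (hh a)) (hab ▸ List.mem_of_head? (hh b))
  obtain ⟨c, hc1, hc2, hc3⟩ := exists_matching_of_disjoint_paths M.Edge p (fun a => (hp a).1)
    (fun a => (hp a).2.1) hdisj
  have hne : ∀ u, (∀ a, (p a).head? ≠ some u) ↔ ∀ a, h a ≠ u := by
    intro u
    simp [hh']
  simp only [hne] at hc1 hc2 hc3
  have hcover : ∀ w, w ∉ (Sum.inl '' Cbar : Set M.Vertex) →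
      ∃ u, (∀ a, h a ≠ u) ∧ c u = w ∧ (u = w ∨ M.Edge w u) := by
    intro w hw
    refine hc3 w fun a ha => hw ?_
    obtain ⟨v, hv, hvC⟩ := (hp a).2.2.2
    have hv' : (p a).getLast? = some v := hv
    rw [ha] at hv'
    exact Option.some_injective _ hv' ▸ hvC
  obtain ⟨SP, hdisjS, hrat⟩ := hIndep.incidence
  have hcinj : Function.Injective
      (fun u : {u : Fin L // ∀ a, h a ≠ Sum.inl u} => c (Sum.inl u.1)) := fun u u' huu' =>
    Subtype.ext (Sum.inl_injective (hc2 u.2 u'.2 huu'))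
  -- The rows are the internal signals that head no path, each matched to its predecessor or to
  -- itself. The matched entry is an edge, or the diagonal entry `-1` of `G - I`.
  filter_upwards [ae_det_submatrix_ne_zero M.Θ hΘ M.incidence SP hdisjS hrat
    (fun m _ _ r c hr hc hd hk => hFixed.det_ne_zero m r c hr hc hd hk)
    {u : Fin L // ∀ a, h a ≠ Sum.inl u} Subtype.val (fun u => c (Sum.inl u.1))
    Subtype.val_injective hcinj (fun u => by
      by_cases hcu : c (Sum.inl u.1) = Sum.inl u.1
      · obtain ⟨θ, hθ⟩ := hΘ
        refine ⟨θ, hθ, ?_⟩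
        rw [hcu]
        simp [incidence, M.G_hollow θ hθ]
      · obtain ⟨θ, hθ, hedge⟩ := (hc1 _ u.2).resolve_left hcu
        refine ⟨θ, hθ, ?_⟩
        rcases hv : c (Sum.inl u.1) with l | e
        · have hul : u.1 ≠ l := fun hul => hcu (by rw [hv, hul])
          rw [hv] at hedge
          simpa [incidence, entry, Matrix.one_apply_ne hul] using hedge
        · rw [hv] at hedge
          simpa [incidence, entry] using hedge)] with θ hdet hθ
  have hli := linearIndependent_responseOn hθ h hinj c hc2 hcover (hdet hθ)
  have h1 := finrank_span_eq_card hli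
  rw [Fintype.card_fin] at h1
  rw [← h1]
  refine Submodule.finrank_mono (Submodule.span_mono ?_)
  rintro _ ⟨a, rfl⟩
  exact ⟨h a, hhS a, rfl⟩

end NetworkModelSet

/-! ### Responses determined by the data -/

namespace NetworkModelSet

variable {L K n : ℕ} {M : NetworkModelSet L K n}

/-- `CTR` and `factor` are the two column blocks of `C T X`. -/
theorem response_inr_eq {θ₀ θ₁ : Fin n → ℝ} (hCTR : M.CTR θ₀ = M.CTR θ₁)
    (hfactor : M.factor θ₀ = M.factor θ₁) {l : Fin L} (hl : l ∈ M.C) (e : M.Ext) :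
    M.response θ₀ (Sum.inr e) l = M.response θ₁ (Sum.inr e) l := by
  have hsel : ∀ {κ : Type} (A : Matrix (Fin L) κ (RatFunc ℝ)) (b : κ),
      (M.selC (RatFunc ℝ) * A) ⟨l, hl⟩ b = A l b := by
    intro κ A b
    simp [selC, Matrix.mul_apply, Matrix.one_apply]
  rcases e with p | a
  · have h := congrFun (congrFun hCTR ⟨l, hl⟩) p
    rw [CTR, CTR, Matrix.mul_assoc, Matrix.mul_assoc, hsel, hsel] at h
    exact h
  · have h := congrFun (congrFun hfactor ⟨l, hl⟩) a
    rw [factor, factor, Matrix.mul_assoc, Matrix.mul_assoc, hsel, hsel] at h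
    exact h

/-- The only nonzero entry in the column of `X` is the known one, so the column is a fixed multiple
of a unit vector. -/
theorem IsKnownExcitation.exists_response_eq {x : M.Ext} {k : Fin L}
    (hx : M.IsKnownExcitation x k) :
    ∃ a : RatFunc ℝ, a ≠ 0 ∧ ∀ θ ∈ M.Θ,
      M.response θ (Sum.inr x) = a • M.response θ (Sum.inl k) := by
  obtain ⟨hdeg, hedge, hknown⟩ := hx
  obtain ⟨θ', hθ', hne⟩ := hedge
  refine ⟨M.X θ' k x, hne, fun θ hθ => ?_⟩
  have hsource : M.source θ (Sum.inr x) = M.X θ' k x • M.source θ (Sum.inl k) := by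
    ext u
    by_cases huk : u = k
    · subst huk
      simpa [source, entry] using hknown θ hθ θ' hθ'
    · obtain ⟨v, hv⟩ := Set.ncard_eq_one.mp hdeg
      have h1 : (Sum.inl k : M.Vertex) ∈ {u | M.Edge (Sum.inr x) u} := ⟨θ', hθ', hne⟩
      have h2 : ¬ M.Edge (Sum.inr x) (Sum.inl u) := by
        intro hedge
        have h3 : (Sum.inl u : M.Vertex) ∈ {u | M.Edge (Sum.inr x) u} := hedge
        rw [hv] at h1 h3
        exact huk (Sum.inl_injective ((h3 : _ = v).trans (h1 : _ = v).symm))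
      have h3 : M.X θ u x = 0 := by
        by_contra h0
        exact h2 ⟨θ, hθ, h0⟩
      simp [source, h3, huk]
  rw [response, hsource, Matrix.mulVec_smul]
  rfl

theorem IsKnownExcitation.response_inl_eq {x : M.Ext} {k : Fin L} (hx : M.IsKnownExcitation x k)
    {θ₀ θ₁ : Fin n → ℝ} (h₀ : θ₀ ∈ M.Θ) (h₁ : θ₁ ∈ M.Θ) (hCTR : M.CTR θ₀ = M.CTR θ₁)
    (hfactor : M.factor θ₀ = M.factor θ₁) {l : Fin L} (hl : l ∈ M.C) :
    M.response θ₀ (Sum.inl k) l = M.response θ₁ (Sum.inl k) l := by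
  obtain ⟨a, ha, h⟩ := hx.exists_response_eq
  have h2 := response_inr_eq hCTR hfactor hl x
  rw [h θ₀ h₀, h θ₁ h₁] at h2
  exact mul_left_cancel₀ ha h2

/-- Column `i` of `T (I - G) = I`. -/
theorem sum_smul_response {θ : Fin n → ℝ} (hθ : θ ∈ M.Θ) (i : Fin L) :
    ∑ k, M.G θ k i • M.response θ (Sum.inl k) =
      M.response θ (Sum.inl i) - Pi.single i 1 := by
  ext l
  have h := congrFun (congrFun (T_mul_one_sub hθ) l) i
  rw [Matrix.mul_sub, Matrix.mul_one, Matrix.sub_apply, Matrix.mul_apply] at h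
  have h2 : (1 : Matrix (Fin L) (Fin L) (RatFunc ℝ)) l i =
      (Pi.single i 1 : Fin L → RatFunc ℝ) l := by
    rw [Matrix.one_apply, Pi.single_apply]
  rw [h2] at h
  simp only [Finset.sum_apply, Pi.smul_apply, smul_eq_mul, response, source, Sum.elim_inl,
    Matrix.mulVec_single_one, Matrix.col_apply, Pi.sub_apply]
  rw [← h, sub_sub_cancel]
  exact Finset.sum_congr rfl fun k _ => mul_comm _ _

end NetworkModelSet

/-! ### Isolating the module with a linear functional -/

theorem mainTheorem9 {L K n : ℕ} (M : NetworkModelSet L K n)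
    (hRank : M.FullRankSpectrum)
    (hIndep : M.IndependentlyParameterized)
    (hFeed : M.FeedthroughCondition)
    (hFixed : M.FixedEntriesRegular)
    (hMinPhase : M.MinimumPhaseFactor)
    (i j : Fin L) (xi xj : M.Ext)
    (hxi : M.IsKnownExcitation xi i) (hxj : M.IsKnownExcitation xj j)
    (hPaths : ∃ (Xbar : Set M.Ext) (Cbar : Set (Fin L)),
      Xbar ⊆ M.extNoUnknown j \ {xj} ∧ Cbar ⊆ (M.C : Set (Fin L)) ∧
      M.maxDisjointPaths (Sum.inl '' M.Nplus i ∪ Sum.inr '' Xbar) (Sum.inl '' Cbar) =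
        M.maxDisjointPaths (Sum.inl '' (M.Nplus i \ {j}) ∪ Sum.inr '' Xbar) (Sum.inl '' Cbar) + 1 ∧
      M.maxDisjointPaths (Sum.inl '' (M.Nplus i \ {j}) ∪ Sum.inr '' Xbar) (Sum.inl '' Cbar) =
        M.maxDisjointPaths (Sum.inr '' Xbar) (Sum.inl '' Cbar)) :
    M.GenericallyIdentifiable j i := by
  obtain ⟨Xbar, Cbar, -, hCbar, hb1, hb2⟩ := hPaths
  obtain ⟨θ', hθ', -⟩ := hxi.2.1
  have hΘ : M.Θ.Nonempty := ⟨θ', hθ'⟩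
  unfold NetworkModelSet.GenericallyIdentifiable
  filter_upwards [NetworkModelSet.ae_maxDisjointPaths_le_finrank hΘ hIndep hFixed
      (Sum.inl '' M.Nplus i ∪ Sum.inr '' Xbar) Cbar,
    NetworkModelSet.ae_maxDisjointPaths_le_finrank hΘ hIndep hFixed (Sum.inr '' Xbar) Cbar]
    with θ₀ hgen hgenX h₀ θ₁ h₁ hCTR hspec
  have hfactor := NetworkModelSet.factor_eq_of_spectrumC_eq hRank hFeed hMinPhase h₀ h₁ hspec
  have hknown : ∀ k x, M.IsKnownExcitation x k →
      M.responseOn θ₀ Cbar (Sum.inl k) = M.responseOn θ₁ Cbar (Sum.inl k) := fun k x hx =>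
    funext fun c => hx.response_inl_eq h₀ h₁ hCTR hfactor (hCbar c.2)
  let W : Submodule (RatFunc ℝ) (Cbar → RatFunc ℝ) :=
    Submodule.span (RatFunc ℝ) (M.responseOn θ₀ Cbar '' (Sum.inr '' Xbar))
  let W' : (Fin n → ℝ) → Submodule (RatFunc ℝ) (Cbar → RatFunc ℝ) := fun θ =>
    Submodule.span (RatFunc ℝ)
      (M.responseOn θ Cbar '' (Sum.inl '' (M.Nplus i \ {j}) ∪ Sum.inr '' Xbar))
  have himage : ∀ θ, θ = θ₀ ∨ θ = θ₁ → M.responseOn θ Cbar '' (Sum.inr '' Xbar) =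
      M.responseOn θ₀ Cbar '' (Sum.inr '' Xbar) := by
    rintro θ (rfl | rfl)
    · rfl
    · rw [Set.image_image, Set.image_image]
      refine Set.image_congr fun e _ => funext fun c => ?_
      exact (NetworkModelSet.response_inr_eq hCTR hfactor (hCbar c.2) e).symm
  -- The upper bound on the rank of `W' θ` holds for every parameter, and the lower bound on the
  -- rank of `W` is needed only at `θ₀`, since the data give both parameters the same `W`. So `θ₁`
  -- need not be generic.
  have hW : ∀ θ ∈ M.Θ, θ = θ₀ ∨ θ = θ₁ → W = W' θ := by
    intro θ hθ h
    refine Submodule.eq_of_le_of_finrank_le (Submodule.span_mono ?_) ?_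
    · rw [← himage θ h]
      exact Set.image_mono Set.subset_union_right
    · refine (NetworkModelSet.finrank_span_responseOn_le hθ _ Cbar).trans ?_
      rw [hb2]
      exact hgenX h₀
  -- Otherwise `j` would add nothing to the span, against the extra path that `hb1` and genericity
  -- of `θ₀` provide.
  have hj : M.responseOn θ₀ Cbar (Sum.inl j) ∉ W := by
    intro hmem
    have hle : Submodule.span (RatFunc ℝ)
        (M.responseOn θ₀ Cbar '' (Sum.inl '' M.Nplus i ∪ Sum.inr '' Xbar)) ≤ W := by
      rw [Submodule.span_le]
      rintro _ ⟨_, ⟨k, hk, rfl⟩ | hv, rfl⟩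
      · by_cases hkj : k = j
        · rw [hkj]
          exact hmem
        · rw [hW θ₀ h₀ (Or.inl rfl)]
          exact Submodule.subset_span ⟨_, Or.inl ⟨k, ⟨hk, hkj⟩, rfl⟩, rfl⟩
      · exact Submodule.subset_span ⟨_, hv, rfl⟩
    have h1 := (hgen h₀).trans (Submodule.finrank_mono hle)
    have h2 := NetworkModelSet.finrank_span_responseOn_le h₀
      (Sum.inl '' (M.Nplus i \ {j}) ∪ Sum.inr '' Xbar) Cbar
    have h3 : Module.finrank (RatFunc ℝ) W = Module.finrank (RatFunc ℝ) (W' θ₀) := by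
      rw [← hW θ₀ h₀ (Or.inl rfl)]
    have h4 : Module.finrank (RatFunc ℝ) (W' θ₀) ≤ _ := h2
    omega
  obtain ⟨φ, hφj, hφ⟩ := Submodule.exists_le_ker_of_notMem hj
  have hcol : ∀ θ ∈ M.Θ, ∑ k, M.G θ k i * φ (M.responseOn θ Cbar (Sum.inl k)) =
      φ (M.responseOn θ Cbar (Sum.inl i) -
        fun c : Cbar => (Pi.single i 1 : Fin L → RatFunc ℝ) c) := by
    intro θ hθ
    have h : M.responseOn θ Cbar (Sum.inl i) -
        (fun c : Cbar => (Pi.single i 1 : Fin L → RatFunc ℝ) c) =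
        ∑ k, M.G θ k i • M.responseOn θ Cbar (Sum.inl k) := by
      ext c
      have h1 := congrFun (NetworkModelSet.sum_smul_response hθ i) c
      rw [Finset.sum_apply] at h1 ⊢
      exact h1.symm
    rw [h, map_sum]
    simp
  have hsum : ∑ k, M.G θ₀ k i * φ (M.responseOn θ₀ Cbar (Sum.inl k)) =
      ∑ k, M.G θ₁ k i * φ (M.responseOn θ₁ Cbar (Sum.inl k)) := by
    rw [hcol θ₀ h₀, hcol θ₁ h₁, hknown i xi hxi]
  -- Three cases: `φ` kills the response (`k` in `Nplus i`), the module and the response are both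
  -- determined (known edge to an excited vertex), or the module is zero.
  have hother : ∀ k, k ≠ j → M.G θ₀ k i * φ (M.responseOn θ₀ Cbar (Sum.inl k)) =
      M.G θ₁ k i * φ (M.responseOn θ₁ Cbar (Sum.inl k)) := by
    intro k hkj
    by_cases hk : k ∈ M.Nplus i
    · have hker : ∀ θ ∈ M.Θ, θ = θ₀ ∨ θ = θ₁ → φ (M.responseOn θ Cbar (Sum.inl k)) = 0 := by
        intro θ hθ h
        refine hφ ?_
        rw [hW θ hθ h]
        exact Submodule.subset_span ⟨_, Or.inl ⟨k, ⟨hk, hkj⟩, rfl⟩, rfl⟩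
      rw [hker θ₀ h₀ (Or.inl rfl), hker θ₁ h₁ (Or.inr rfl), mul_zero, mul_zero]
    · by_cases hedge : M.Edge (Sum.inl i) (Sum.inl k)
      · have hk' : M.Known (Sum.inl i) k ∧ ∃ x, M.IsKnownExcitation x k := by
          by_contra h
          exact hk ⟨hedge, h⟩
        obtain ⟨hGk, x, hx⟩ := hk'
        have h1 : M.G θ₀ k i = M.G θ₁ k i := hGk θ₀ h₀ θ₁ h₁
        rw [h1, hknown k x hx]
      · have hzero : ∀ θ ∈ M.Θ, M.G θ k i = 0 := by
          intro θ hθ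
          by_contra h0
          exact hedge ⟨θ, hθ, h0⟩
        rw [hzero θ₀ h₀, hzero θ₁ h₁, zero_mul, zero_mul]
  rw [← Finset.add_sum_erase _ _ (Finset.mem_univ j),
    ← Finset.add_sum_erase Finset.univ
      (fun k => M.G θ₁ k i * φ (M.responseOn θ₁ Cbar (Sum.inl k))) (Finset.mem_univ j),
    Finset.sum_congr rfl fun k hk => hother k (Finset.ne_of_mem_erase hk)] at hsum
  have h := add_right_cancel hsum
  -- The excitation of `w_j` gives both sides the same factor `φ` of the response to `w_j`, which is
  -- nonzero and cancels.
  rw [← hknown j xj hxj] at h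
  exact mul_right_cancel₀ hφj h

end
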